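/- Let $F$ be Thompson's group, given by its infinite presentation $$F=\langle x_n,\ n\ge 0 \mid x_i^{-1}x_jx_i=x_{j+1}\ \text{for } i<j\rangle ,$$ which is generated by $X=\{x_0,x_1\}$. Let $\Gamma=\Gamma(F,X)$ be its Cayley graph (edges join $u$ to $ug^{\pm1}$, $g\in X$), with its path metric $d$, and let $|w|=d(1,w)$. Let $\mathcal S$ be the family of elements $$x_0^{m-1}x_1x_{m+2l+2}\,x_{m+2l+1}^{-1}x_{m+2l-1}^{-1}\cdots x_{m+3}^{-1}x_{m+1}^{-1}\,x_0^{-m},\qquad l\ge 1,\ m\ge 2 .$$ An element $w\in F$ is a *seesaw word of swing $n$ with respect to $x_0$* if, with $X^{\pm}=\{x_0^{\pm1},x_1^{\pm1}\}$: 1. $|wx_0^{\pm1}|=|w|-1$, and $|wh|\ge |w|$ for $h\in X^{\pm}\setminus\{x_0^{\pm1}\}$; 2. for each sign $\varepsilon=\pm1$, $|wx_0^{\varepsilon i}|=|wx_0^{\varepsilon(i-1)}|-1$ for $1\le i\le n$, and $|wx_0^{\varepsilon i}h|\ge|wx_0^{\varepsilon i}|$ for $1\le i\le n-1$ and all $h\in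 X^{\pm}\setminus\{x_0^{\varepsilon}\}$. For a path $\gamma$ in $\Gamma$ from the identity to $v$, let $\gamma(i)$ be its vertex after $i$ steps, with $\gamma(i)=v$ once $i$ is at least the length of $\gamma$. A collection of paths from the identity, one to each element of a set of vertices, satisfies the *$k$-fellow traveller property* if any two paths $\gamma,\eta$ of the collection whose end points are at distance one satisfy $\max_i d(\gamma(i),\eta(i))\le k$. **Proposition.** For every constant $k\in\mathbb N$ there is $w\in\mathcal S$, a seesaw word of some swing $n\ge1$ with respect to $x_0$, such that no collection of geodesic paths in $\Gamma$ from the identity, one to each of $w$, $wx_0$ and $wx_0^{-1}$, satisfies the $k$-fellow traveller property. -/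

import Mathlib

namespace Seesaw

/-! ### Cayley graphs, word length and the fellow traveller property

`SimpleGraph.mulCayley X` is Mathlib's Cayley graph: `u` and `v` are adjacent when `u ≠ v` and
`v = u * g` or `u = v * g` for some `g ∈ X`.  A path from `1` to `v` is a `Walk 1 v`; for such a
walk `p`, the vertex `p.getVert i` is the one reached after `i` steps, and is `v` for every
`i ≥ p.length`. -/

/-- The length of `w` with respect to the generating set `X`: the distance from `1` to `w` in the
Cayley graph. -/
noncomputable def wordLength {G : Type*} [Group G] (X : Set G) (w : G) : ℕ :=
  (SimpleGraph.mulCayley X).dist 1 w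

/-- A path is geodesic if its length is the distance between its end points. -/
def IsGeodesic {V : Type*} {Γ : SimpleGraph V} {u v : V} (p : Γ.Walk u v) : Prop :=
  p.length = Γ.dist u v

/-- The synchronous distance of two paths: the supremum over all times `i` of the distance
between their positions at time `i`. -/
noncomputable def syncDist {V : Type*} {Γ : SimpleGraph V} {o u v : V}
    (p : Γ.Walk o u) (q : Γ.Walk o v) : ℕ∞ :=
  ⨆ i : ℕ, Γ.edist (p.getVert i) (q.getVert i)

/-- A collection of paths from `o`, one to each vertex of `S`, satisfies the `k`-fellow traveller
property if any two of its paths whose end points are at distance one have synchronous distance at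
most `k`. -/
def FellowTraveller {V : Type*} {Γ : SimpleGraph V} {o : V} {S : Set V} (k : ℕ)
    (γ : ∀ v : S, Γ.Walk o v) : Prop :=
  ∀ u v : S, Γ.dist (u : V) v = 1 → syncDist (γ u) (γ v) ≤ k

/-! ### Seesaw words -/

/-- `w` is a seesaw word of swing `k` with respect to the generator `g`, for the finite generating
set `X`.  The competing steps `h` range over the generators and their inverses. -/
structure IsSeesaw {G : Type*} [Group G] (X : Set G) (g : G) (k : ℕ) (w : G) : Prop where
  finite : X.Finite
  generates : Subgroup.closure X = ⊤
  mem : g ∈ X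
  /-- Both `g` and `g⁻¹` reduce the length of `w`. -/
  down_pos : wordLength X (w * g) + 1 = wordLength X w
  down_neg : wordLength X (w * g⁻¹) + 1 = wordLength X w
  /-- No other generator or inverse of a generator does. -/
  other : ∀ h, h ∈ X ∨ h⁻¹ ∈ X → h ≠ g → h ≠ g⁻¹ → wordLength X w ≤ wordLength X (w * h)
  /-- After a step in the direction of `g`, only `g` reduces the length, for `k` steps in all. -/
  swing_pos : ∀ i, 1 ≤ i → i ≤ k →
    wordLength X (w * g ^ i) + 1 = wordLength X (w * g ^ (i - 1))
  only_pos : ∀ i, 1 ≤ i → i < k → ∀ h, h ∈ X ∨ h⁻¹ ∈ X → h ≠ g →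
    wordLength X (w * g ^ i) ≤ wordLength X (w * g ^ i * h)
  /-- After a step in the direction of `g⁻¹`, only `g⁻¹` reduces the length, for `k` steps. -/
  swing_neg : ∀ i, 1 ≤ i → i ≤ k →
    wordLength X (w * g⁻¹ ^ i) + 1 = wordLength X (w * g⁻¹ ^ (i - 1))
  only_neg : ∀ i, 1 ≤ i → i < k → ∀ h, h ∈ X ∨ h⁻¹ ∈ X → h ≠ g⁻¹ →
    wordLength X (w * g⁻¹ ^ i) ≤ wordLength X (w * g⁻¹ ^ i * h)

/-! ### Thompson's group `F` -/

/-- The relators `x_i⁻¹ x_j x_i x_{j+1}⁻¹`, for `i < j`. -/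
def thompsonRels : Set (FreeGroup ℕ) :=
  {r | ∃ i j : ℕ, i < j ∧
    r = (FreeGroup.of i)⁻¹ * FreeGroup.of j * FreeGroup.of i * (FreeGroup.of (j + 1))⁻¹}

/-- Thompson's group `F = ⟨x_n, n ≥ 0 | x_i⁻¹ x_j x_i = x_{j+1} for i < j⟩`. -/
abbrev ThompsonF : Type := PresentedGroup thompsonRels

/-- The generators `x_n` of the infinite presentation. -/
def x (n : ℕ) : ThompsonF := PresentedGroup.of n

/-- The standard finite generating set `{x_0, x_1}`. -/
def gens : Set ThompsonF := {x 0, x 1}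

/-- The Cayley graph of `F` with respect to `{x_0, x_1}`. -/
def cayleyF : SimpleGraph ThompsonF := SimpleGraph.mulCayley gens

/-- The word
`x_0^{m-1} x_1 x_{m+2l+2} x_{m+2l+1}⁻¹ x_{m+2l-1}⁻¹ ⋯ x_{m+3}⁻¹ x_{m+1}⁻¹ x_0^{-m}`. -/
def seesawWord (l m : ℕ) : ThompsonF :=
  x 0 ^ (m - 1) * x 1 * x (m + 2 * l + 2) *
    ((List.range (l + 1)).reverse.map fun i => (x (m + 2 * i + 1))⁻¹).prod * (x 0 ^ m)⁻¹

/-- The two-parameter family `𝒮` of seesaw words.  All exponents of the normal form are positive,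
so that `m ≥ 2`. -/
def seesawFamily : Set ThompsonF :=
  {w | ∃ l m : ℕ, 1 ≤ l ∧ 2 ≤ m ∧ w = seesawWord l m}

end Seesaw

namespace Seesaw
/-! ### The generators as order automorphisms of `ℚ` -/

/-- The piecewise linear map which is the identity on the negative half-line, maps `[0, 2]`
linearly onto `[0, 1]`, and is a translation beyond. -/
def half (z : ℚ) : ℚ := if z ≤ 0 then z else if z ≤ 2 then z / 2 else z - 1

/-- The inverse of `half`. -/
def double (z : ℚ) : ℚ := if z ≤ 0 then z else if z ≤ 1 then 2 * z else z + 1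

theorem double_half (z : ℚ) : double (half z) = z := by
  unfold double half; split_ifs <;> linarith

theorem half_double (z : ℚ) : half (double z) = z := by
  unfold double half; split_ifs <;> linarith

theorem half_strictMono : StrictMono half := by
  intro a b h
  unfold half; split_ifs <;> linarith

/-- `half` as an order automorphism. -/
def halfIso : ℚ ≃o ℚ where
  toFun := half
  invFun := double
  left_inv := double_half
  right_inv := half_double
  map_rel_iff' := half_strictMono.le_iff_le

/-- Translation by `-1`, as an order automorphism. -/
def shiftIso : ℚ ≃o ℚ := OrderIso.addRight (-1)

/-- The automorphism of `ℚ` by which `x n` acts. -/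
def genIso : ℕ → (ℚ ≃o ℚ)
  | 0 => shiftIso
  | n + 1 => shiftIso⁻¹ ^ n * halfIso * shiftIso ^ n

theorem shiftIso_apply (z : ℚ) : shiftIso z = z - 1 := by
  simp [shiftIso, sub_eq_add_neg]

theorem shiftIso_inv_apply (z : ℚ) : shiftIso⁻¹ z = z + 1 := by
  apply shiftIso.injective
  rw [RelIso.apply_inv_self, shiftIso_apply]; ring

theorem halfIso_inv_apply (z : ℚ) : halfIso⁻¹ z = double z := rfl

theorem halfIso_apply (z : ℚ) : halfIso z = half z := rfl

theorem shiftIso_pow_apply (n : ℕ) (z : ℚ) : (shiftIso ^ n) z = z - n := by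
  induction n generalizing z with
  | zero => simp
  | succ n ih => rw [pow_succ, RelIso.mul_apply, ih, shiftIso_apply]; push_cast; ring

theorem shiftIso_inv_pow_apply (n : ℕ) (z : ℚ) : (shiftIso⁻¹ ^ n) z = z + n := by
  induction n generalizing z with
  | zero => simp
  | succ n ih => rw [pow_succ, RelIso.mul_apply, ih, shiftIso_inv_apply]; push_cast; ring

theorem genIso_succ_apply (n : ℕ) (z : ℚ) : genIso (n + 1) z = half (z - n) + n := by
  simp only [genIso, RelIso.mul_apply, shiftIso_pow_apply, shiftIso_inv_pow_apply, halfIso_apply]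

theorem genIso_mul (i j : ℕ) (h : i < j) :
    genIso j * genIso i = genIso i * genIso (j + 1) := by
  obtain ⟨j, rfl⟩ : ∃ b, j = b + 1 := ⟨j - 1, by omega⟩
  rcases i with _ | i
  · apply RelIso.ext
    intro z
    simp only [RelIso.mul_apply, genIso_succ_apply]
    simp only [genIso, shiftIso_apply]
    push_cast
    rw [show z - 1 - (j : ℚ) = z - (j + 1) by ring]
    ring
  · apply RelIso.ext
    intro z
    simp only [RelIso.mul_apply, genIso_succ_apply]
    have : (i : ℚ) + 1 ≤ j := by exact_mod_cast Nat.lt_of_succ_lt_succ h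
    push_cast
    unfold half
    split_ifs <;> linarith

/-- The action of Thompson's group on `ℚ` by order automorphisms. -/
def action : ThompsonF →* (ℚ ≃o ℚ) :=
  PresentedGroup.toGroup (f := genIso) (by
    rintro r ⟨i, j, h, rfl⟩
    simp only [map_mul, map_inv, FreeGroup.lift_apply_of]
    rw [mul_inv_eq_one, mul_assoc, inv_mul_eq_iff_eq_mul, genIso_mul i j h])

theorem action_x (n : ℕ) : action (x n) = genIso n := PresentedGroup.toGroup.of _

theorem action_x_zero : action (x 0) = shiftIso := action_x 0

theorem action_x_one : action (x 1) = halfIso := by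
  rw [action_x]; simp [genIso]

/-- The exponent sum of `x 0`, as a homomorphism. -/
def expSum : ThompsonF →* Multiplicative ℤ :=
  PresentedGroup.toGroup (f := fun n : ℕ => Multiplicative.ofAdd (if n = 0 then (1 : ℤ) else 0)) (by
    rintro r ⟨i, j, h, rfl⟩
    have : j ≠ 0 := by omega
    simp [FreeGroup.lift_apply_of, this])

theorem expSum_x_zero : (expSum (x 0)).toAdd = 1 := by
  simp [expSum, x]

theorem expSum_x_one : (expSum (x 1)).toAdd = 0 := by
  simp [expSum, x]

/-! ### Relations and generation -/

theorem x_rel {i j : ℕ} (h : i < j) : (x i)⁻¹ * x j * x i = x (j + 1) := by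
  have : (PresentedGroup.mk thompsonRels)
      ((FreeGroup.of i)⁻¹ * FreeGroup.of j * FreeGroup.of i * (FreeGroup.of (j + 1))⁻¹) = 1 :=
    PresentedGroup.one_of_mem ⟨i, j, h, rfl⟩
  simp only [map_mul, map_inv] at this
  exact mul_inv_eq_one.mp this

theorem closure_gens : Subgroup.closure gens = ⊤ := by
  have h0 : x 0 ∈ Subgroup.closure gens := Subgroup.subset_closure (by simp [gens])
  have h : ∀ n, x (n + 1) ∈ Subgroup.closure gens := by
    intro n
    induction n with
    | zero => exact Subgroup.subset_closure (by simp [gens])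
    | succ n ih =>
      rw [← x_rel (Nat.succ_pos n)]
      exact mul_mem (mul_mem (inv_mem h0) ih) h0
  rw [eq_top_iff, ← PresentedGroup.closure_range_of, Subgroup.closure_le]
  rintro _ ⟨n, rfl⟩
  rcases n with _ | n
  · exact h0
  · exact h n

/-! ### Positions, and how a step of the Cayley graph moves them -/

/-- The position of the point `c` as seen from the vertex `g`. -/
def pos (g : ThompsonF) (c : ℚ) : ℚ := (action g)⁻¹ c

theorem pos_one (c : ℚ) : pos 1 c = c := by simp [pos]

theorem pos_mul (g h : ThompsonF) (c : ℚ) : pos (g * h) c = (action h)⁻¹ (pos g c) := by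
  simp [pos, mul_inv_rev]

theorem pos_strictMono (g : ThompsonF) : StrictMono (pos g) := (action g)⁻¹.strictMono

theorem pos_eq_iff (g : ThompsonF) (c z : ℚ) : pos g c = z ↔ c = action g z := by
  unfold pos
  constructor
  · rintro rfl; simp
  · rintro rfl; simp

theorem pos_mul_x_zero (g : ThompsonF) (c : ℚ) : pos (g * x 0) c = pos g c + 1 := by
  rw [pos_mul, action_x_zero, shiftIso_inv_apply]

theorem pos_mul_x_zero_inv (g : ThompsonF) (c : ℚ) : pos (g * (x 0)⁻¹) c = pos g c - 1 := by
  rw [pos_mul, map_inv, inv_inv, action_x_zero, shiftIso_apply]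

theorem pos_mul_x_one (g : ThompsonF) (c : ℚ) : pos (g * x 1) c = double (pos g c) := by
  rw [pos_mul, action_x_one, halfIso_inv_apply]

theorem pos_mul_x_one_inv (g : ThompsonF) (c : ℚ) : pos (g * (x 1)⁻¹) c = half (pos g c) := by
  rw [pos_mul, map_inv, inv_inv, action_x_one, halfIso_apply]

theorem pos_mul_x_zero_pow (g : ThompsonF) (n : ℕ) (c : ℚ) :
    pos (g * x 0 ^ n) c = pos g c + n := by
  rw [pos_mul, map_pow, ← inv_pow, action_x_zero, shiftIso_inv_pow_apply]

theorem pos_mul_x_zero_inv_pow (g : ThompsonF) (n : ℕ) (c : ℚ) :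
    pos (g * (x 0)⁻¹ ^ n) c = pos g c - n := by
  rw [pos_mul, map_pow, map_inv, ← inv_pow, inv_inv, action_x_zero, shiftIso_pow_apply]

/-- One step in the Cayley graph. -/
def Step (g g' : ThompsonF) : Prop :=
  g' = g * x 0 ∨ g' = g * (x 0)⁻¹ ∨ g' = g * x 1 ∨ g' = g * (x 1)⁻¹

theorem step_of_adj {g g' : ThompsonF} (h : (SimpleGraph.mulCayley gens).Adj g g') :
    Step g g' := by
  rw [SimpleGraph.mulCayley_adj'] at h
  obtain ⟨-, s, hs, h | h⟩ := h <;> rcases hs with rfl | hs <;>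
    try rw [Set.mem_singleton_iff] at hs
  · exact Or.inl h.symm
  · subst hs; exact Or.inr (Or.inr (Or.inl h.symm))
  · exact Or.inr (Or.inl (by rw [h]; group))
  · subst hs; exact Or.inr (Or.inr (Or.inr (by rw [h]; group)))

/-- The zone of a position: `0` for the integers `≤ 0`, `1` for the integers `≥ 1`, and `2` for
the non-integers. -/
noncomputable def zone (z : ℚ) : ℤ :=
  open Classical in if ∃ n : ℤ, (n : ℚ) = z then (if z ≤ 0 then 0 else 1) else 2

theorem zone_of_nonpos {z : ℚ} (n : ℤ) (h : z = n) (hn : n ≤ 0) : zone z = 0 := by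
  have : z ≤ 0 := by rw [h]; exact_mod_cast hn
  rw [zone, if_pos ⟨n, h.symm⟩, if_pos this]

theorem zone_of_pos {z : ℚ} (n : ℤ) (h : z = n) (hn : 1 ≤ n) : zone z = 1 := by
  have : ¬ z ≤ 0 := by rw [h]; push Not; exact_mod_cast hn
  rw [zone, if_pos ⟨n, h.symm⟩, if_neg this]

theorem zone_of_not_int {z : ℚ} (n : ℤ) (h : (n : ℚ) < z) (h' : z < n + 1) : zone z = 2 := by
  rw [zone, if_neg]
  rintro ⟨a, rfl⟩
  norm_cast at h h'
  omega

theorem zone_cases (z : ℚ) :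
    (∃ n : ℤ, z = n ∧ n ≤ 0 ∧ zone z = 0) ∨ (∃ n : ℤ, z = n ∧ 1 ≤ n ∧ zone z = 1) ∨
      (∃ n : ℤ, (n : ℚ) < z ∧ z < n + 1 ∧ zone z = 2) := by
  by_cases h : ∃ n : ℤ, (n : ℚ) = z
  · obtain ⟨n, hn⟩ := h
    rcases le_or_gt n 0 with h | h
    · exact Or.inl ⟨n, hn.symm, h, zone_of_nonpos n hn.symm h⟩
    · exact Or.inr (Or.inl ⟨n, hn.symm, h, zone_of_pos n hn.symm h⟩)
  · refine Or.inr (Or.inr ⟨⌊z⌋, ?_, Int.lt_floor_add_one z, ?_⟩)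
    · exact lt_of_le_of_ne (Int.floor_le z) fun h' => h ⟨_, h'⟩
    · rw [zone, if_neg h]

theorem zone_add_one {z : ℚ} (h : z ≠ 0) : zone (z + 1) = zone z := by
  rcases zone_cases z with ⟨n, rfl, hn, e⟩ | ⟨n, rfl, hn, e⟩ | ⟨n, h1, h2, e⟩ <;> rw [e]
  · have : n ≠ 0 := by exact_mod_cast h
    exact zone_of_nonpos (n + 1) (by push_cast; rfl) (by omega)
  · exact zone_of_pos (n + 1) (by push_cast; rfl) (by omega)
  · exact zone_of_not_int (n + 1) (by push_cast; linarith) (by push_cast; linarith)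

theorem zone_double {z : ℚ} (h : z ≠ 1 / 2) : zone (double z) = zone z := by
  unfold double
  split_ifs with h0 h1
  · rfl
  · rcases zone_cases z with ⟨n, rfl, hn, e⟩ | ⟨n, rfl, hn, e⟩ | ⟨n, h3, h4, e⟩ <;> rw [e]
    · exact absurd (by exact_mod_cast hn) h0
    · norm_cast at h1
      obtain rfl : n = 1 := by omega
      exact zone_of_pos 2 (by norm_num) (by norm_num)
    · have hn : n = 0 := by
        have a : (n : ℚ) < 1 := by linarith
        have b : (-1 : ℚ) < n := by linarith
        have a' : n < 1 := by exact_mod_cast a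
        have b' : -1 < n := by exact_mod_cast b
        omega
      subst hn
      push_cast at h3 h4
      rcases lt_or_gt_of_ne h with h | h
      · exact zone_of_not_int 0 (by push_cast; linarith) (by push_cast; linarith)
      · exact zone_of_not_int 1 (by push_cast; linarith) (by push_cast; linarith)
  · exact zone_add_one fun h => h0 h.le

/-- A step changes the zone of at most one point, and by at most one. -/
theorem Step.zone_change {g g' : ThompsonF} (h : Step g g') :
    ∃ d, ∀ c, |zone (pos g' c) - zone (pos g c)| ≤ if c = d then 1 else 0 := by
  have key : ∀ g g' : ThompsonF, ∀ z₀ : ℚ,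
      (∀ c, pos g c ≠ z₀ → zone (pos g' c) = zone (pos g c)) →
      (∀ c, pos g c = z₀ → |zone (pos g' c) - zone (pos g c)| ≤ 1) →
      ∃ d, ∀ c, |zone (pos g' c) - zone (pos g c)| ≤ if c = d then 1 else 0 := by
    intro g g' z₀ h1 h2
    refine ⟨action g z₀, fun c => ?_⟩
    split_ifs with hc
    · exact h2 c ((pos_eq_iff _ _ _).2 hc)
    · rw [h1 c fun h => hc ((pos_eq_iff _ _ _).1 h)]; simp
  have z0 : zone 0 = 0 := zone_of_nonpos 0 (by norm_num) le_rfl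
  have z1 : zone 1 = 1 := zone_of_pos 1 (by norm_num) le_rfl
  have zh : zone (1 / 2) = 2 := zone_of_not_int 0 (by norm_num) (by norm_num)
  have d1 : double (1 / 2) = 1 := by norm_num [double]
  have d2 : half 1 = 1 / 2 := by norm_num [half]
  rcases h with rfl | rfl | rfl | rfl
  · refine key _ _ 0 (fun c hc => ?_) (fun c hc => ?_)
    · rw [pos_mul_x_zero, zone_add_one hc]
    · rw [pos_mul_x_zero, hc, zero_add, z0, z1]; norm_num
  · refine key _ _ 1 (fun c hc => ?_) (fun c hc => ?_)
    · rw [pos_mul_x_zero_inv, ← zone_add_one (z := pos g c - 1) (sub_ne_zero.2 hc),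
        sub_add_cancel]
    · rw [pos_mul_x_zero_inv, hc, sub_self, z0, z1]; norm_num
  · refine key _ _ (1 / 2) (fun c hc => ?_) (fun c hc => ?_)
    · rw [pos_mul_x_one, zone_double hc]
    · rw [pos_mul_x_one, hc, d1, zh, z1]; norm_num
  · refine key _ _ 1 (fun c hc => ?_) (fun c hc => ?_)
    · rw [pos_mul_x_one_inv, ← zone_double (z := half (pos g c)), double_half]
      intro h
      apply hc
      rw [← double_half (pos g c), h, d1]
    · rw [pos_mul_x_one_inv, hc, d2, zh, z1]; norm_num

/-! ### Dyadic intervals -/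

/-- `[p, r]` is a standard dyadic interval of length at most one, with midpoint `q`. -/
def Dyadic (p q r : ℚ) : Prop :=
  ∃ (k : ℕ) (a : ℤ), p = a / 2 ^ k ∧ q = (2 * a + 1) / 2 ^ (k + 1) ∧ r = (a + 1) / 2 ^ k

theorem Dyadic.add_int {p q r : ℚ} (h : Dyadic p q r) (n : ℤ) :
    Dyadic (p + n) (q + n) (r + n) := by
  obtain ⟨k, a, rfl, rfl, rfl⟩ := h
  refine ⟨k, a + n * 2 ^ k, ?_, ?_, ?_⟩ <;> push_cast <;> field_simp <;> ring

theorem Dyadic.within_unit {p q r : ℚ} (h : Dyadic p q r) (n : ℤ) : r ≤ n ∨ n ≤ p := by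
  obtain ⟨k, a, rfl, rfl, rfl⟩ := h
  rw [div_le_iff₀ (by positivity), le_div_iff₀ (by positivity)]
  rcases lt_or_ge a (n * 2 ^ k) with h | h
  · left; exact_mod_cast h
  · right; exact_mod_cast h

theorem Dyadic.lt {p q r : ℚ} (h : Dyadic p q r) : p < q ∧ q < r := by
  obtain ⟨k, a, rfl, rfl, rfl⟩ := h
  constructor
  · rw [div_lt_div_iff₀ (by positivity) (by positivity), pow_succ]
    have : (0 : ℚ) < 2 ^ k := by positivity
    nlinarith
  · rw [div_lt_div_iff₀ (by positivity) (by positivity), pow_succ]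
    have : (0 : ℚ) < 2 ^ k := by positivity
    nlinarith

theorem Dyadic.half_mul {p q r : ℚ} (h : Dyadic p q r) : Dyadic (p / 2) (q / 2) (r / 2) := by
  obtain ⟨k, a, rfl, rfl, rfl⟩ := h
  refine ⟨k + 1, a, ?_, ?_, ?_⟩ <;> field_simp <;> ring

theorem Dyadic.not_int {p q r : ℚ} (h : Dyadic p q r) : zone q = 2 := by
  obtain ⟨h1, h2⟩ := h.lt
  rcases zone_cases q with ⟨n, rfl, hn, e⟩ | ⟨n, rfl, hn, e⟩ | ⟨n, h3, h4, e⟩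
  · rcases h.within_unit n with h | h <;> linarith
  · rcases h.within_unit n with h | h <;> linarith
  · exact e

theorem Dyadic.double {p q r : ℚ} (h : Dyadic p q r) :
    Dyadic (double p) (double q) (double r) ∨ (p = 0 ∧ q = 1 / 2 ∧ r = 1) := by
  obtain ⟨h1, h2⟩ := h.lt
  have u0 := h.within_unit 0
  have u1 := h.within_unit 1
  push_cast at u0 u1
  rcases u0 with u0 | u0
  · left
    rw [Seesaw.double, if_pos (by linarith), Seesaw.double, if_pos (by linarith), Seesaw.double,
      if_pos u0]
    exact h
  rcases u1 with u1 | u1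
  · obtain ⟨k, a, rfl, rfl, rfl⟩ := h
    have e : ∀ z : ℚ, 0 ≤ z → z ≤ 1 → Seesaw.double z = 2 * z := by
      intro z h0 h1
      unfold Seesaw.double
      split_ifs <;> linarith
    rcases k with _ | k
    · right
      simp only [pow_zero, div_one] at u0 u1
      norm_cast at u0 u1
      obtain rfl : a = 0 := by omega
      norm_num
    · left
      rw [e _ (by linarith) (by linarith), e _ (by linarith) (by linarith),
        e _ (by linarith) (by linarith)]
      refine ⟨k, a, ?_, ?_, ?_⟩ <;> field_simp <;> ring
  · left
    have e : ∀ z : ℚ, 1 ≤ z → Seesaw.double z = z + 1 := by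
      intro z h1
      unfold Seesaw.double
      split_ifs <;> linarith
    rw [e _ u1, e _ (by linarith), e _ (by linarith)]
    exact_mod_cast h.add_int 1

theorem Dyadic.half {p q r : ℚ} (h : Dyadic p q r) : Dyadic (half p) (half q) (half r) := by
  obtain ⟨h1, h2⟩ := h.lt
  have u0 := h.within_unit 0
  have u2 := h.within_unit 2
  push_cast at u0 u2
  rcases u0 with u0 | u0
  · rw [Seesaw.half, if_pos (by linarith), Seesaw.half, if_pos (by linarith), Seesaw.half,
      if_pos u0]
    exact h
  rcases u2 with u2 | u2
  · have e : ∀ z : ℚ, 0 ≤ z → z ≤ 2 → Seesaw.half z = z / 2 := by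
      intro z h0 h1
      unfold Seesaw.half
      split_ifs <;> linarith
    rw [e _ (by linarith) (by linarith), e _ (by linarith) (by linarith),
        e _ (by linarith) (by linarith)]
    exact h.half_mul
  · have e : ∀ z : ℚ, 2 ≤ z → Seesaw.half z = z - 1 := by
      intro z h1
      unfold Seesaw.half
      split_ifs <;> linarith
    rw [e _ u2, e _ (by linarith), e _ (by linarith)]
    have := h.add_int (-1)
    push_cast at this
    simpa only [sub_eq_add_neg] using this

/-- A step carries a dyadic interval to a dyadic interval, unless it splits it. -/
theorem Step.dyadic {g g' : ThompsonF} (h : Step g g') {a b c : ℚ}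
    (hd : Dyadic (pos g a) (pos g b) (pos g c)) :
    Dyadic (pos g' a) (pos g' b) (pos g' c) ∨
      (pos g a = 0 ∧ pos g b = 1 / 2 ∧ pos g c = 1 ∧ pos g' b = 1) := by
  rcases h with rfl | rfl | rfl | rfl
  · left
    simp only [pos_mul_x_zero]
    exact_mod_cast hd.add_int 1
  · left
    simp only [pos_mul_x_zero_inv]
    have := hd.add_int (-1)
    push_cast at this
    simpa only [sub_eq_add_neg] using this
  · simp only [pos_mul_x_one]
    rcases hd.double with h | ⟨h1, h2, h3⟩
    · exact Or.inl h
    · exact Or.inr ⟨h1, h2, h3, by rw [h2]; norm_num [Seesaw.double]⟩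
  · left
    simp only [pos_mul_x_one_inv]
    exact hd.half

/-! ### Two short words for the elements of the family -/

/-- The product `x_{a+2l}⁻¹ x_{a+2l-2}⁻¹ ⋯ x_a⁻¹`. -/
def joins (l a : ℕ) : ThompsonF :=
  ((List.range (l + 1)).reverse.map fun i => (x (a + 2 * i))⁻¹).prod

theorem joins_zero (a : ℕ) : joins 0 a = (x a)⁻¹ := by simp [joins]

theorem joins_succ (l a : ℕ) : joins (l + 1) a = (x (a + 2 * (l + 1)))⁻¹ * joins l a := by
  simp [joins, List.range_succ (n := l + 1)]

theorem joins_succ' (l a : ℕ) : joins (l + 1) a = joins l (a + 2) * (x a)⁻¹ := by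
  induction l with
  | zero => rw [joins_succ, joins_zero, joins_zero]
  | succ l ih =>
    rw [joins_succ, ih, joins_succ, mul_assoc]
    congr 3
    ring

theorem joins_conj {i a : ℕ} (h : i < a) (l : ℕ) :
    (x i)⁻¹ * joins l a * x i = joins l (a + 1) := by
  induction l with
  | zero =>
    rw [joins_zero, joins_zero, ← x_rel h]
    group
  | succ l ih =>
    rw [joins_succ, joins_succ, ← ih, show a + 1 + 2 * (l + 1) = a + 2 * (l + 1) + 1 by ring,
      ← x_rel (show i < a + 2 * (l + 1) by omega)]
    group

/-- The product `x_{a+2l+1} x_{a+2l}⁻¹ x_{a+2l-2}⁻¹ ⋯ x_a⁻¹`. -/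
def tailWord (l a : ℕ) : ThompsonF := x (a + 2 * l + 1) * joins l a

theorem tailWord_conj {i a : ℕ} (h : i < a) (l : ℕ) :
    (x i)⁻¹ * tailWord l a * x i = tailWord l (a + 1) := by
  rw [tailWord, tailWord, ← joins_conj h, show a + 1 + 2 * l + 1 = a + 2 * l + 1 + 1 by ring,
    ← x_rel (show i < a + 2 * l + 1 by omega)]
  group

theorem tailWord_conj_pow (a l k : ℕ) :
    tailWord l (a + 1 + k) = (x 0 ^ k)⁻¹ * tailWord l (a + 1) * x 0 ^ k := by
  induction k with
  | zero => simp
  | succ k ih =>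
    rw [← add_assoc, ← tailWord_conj (show 0 < a + 1 + k by omega), ih, pow_succ]
    group

theorem tailWord_succ (l a : ℕ) :
    tailWord (l + 1) (a + 1) = (x (a + 1))⁻¹ * (x 0)⁻¹ * tailWord l (a + 1) * x 0 := by
  have h1 : tailWord (l + 1) (a + 1) = (x (a + 1))⁻¹ * tailWord l (a + 2) := by
    rw [tailWord, tailWord, joins_succ', ← joins_conj (show a + 1 < a + 2 by omega),
      show a + 1 + 2 * (l + 1) + 1 = a + 2 + 2 * l + 1 + 1 by ring,
      ← x_rel (show a + 1 < a + 2 + 2 * l + 1 by omega)]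
    group
  rw [h1, ← tailWord_conj (show 0 < a + 1 by omega)]
  group

theorem tailWord_one (l : ℕ) :
    tailWord l 1 = ((x 1)⁻¹ * (x 0)⁻¹) ^ l * (x 0)⁻¹ * x 1 * x 0 * (x 1)⁻¹ * x 0 ^ l := by
  induction l with
  | zero =>
    rw [tailWord, joins_zero, ← x_rel (show 0 < 1 + 2 * 0 by omega)]
    simp
  | succ l ih =>
    rw [show (1 : ℕ) = 0 + 1 from rfl, tailWord_succ, zero_add, ih, pow_succ' _ l, pow_succ _ l]
    simp only [mul_assoc]

theorem seesawWord_eq_tailWord (l m : ℕ) :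
    seesawWord l m = x 0 ^ (m - 1) * x 1 * tailWord l (m + 1) * (x 0 ^ m)⁻¹ := by
  have : (fun i => (x (m + 2 * i + 1))⁻¹) = fun i => (x (m + 1 + 2 * i))⁻¹ := by
    funext i; congr 2; ring
  rw [seesawWord, tailWord, joins, this, show m + 1 + 2 * l + 1 = m + 2 * l + 2 by ring]
  simp only [mul_assoc]

/-- A word for the seesaw element that visits the left end first. -/
theorem seesawWord_left_first (l a : ℕ) :
    seesawWord l (a + 1) = x 0 ^ a * x 1 * (x 0)⁻¹ ^ (a + 1) * ((x 1)⁻¹ * (x 0)⁻¹) ^ l *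
      (x 0)⁻¹ * x 1 * x 0 * (x 1)⁻¹ * x 0 ^ l := by
  rw [seesawWord_eq_tailWord, show a + 1 + 1 = 0 + 1 + (a + 1) by ring, tailWord_conj_pow,
    zero_add, tailWord_one, Nat.add_sub_cancel, inv_pow]
  simp only [mul_assoc, mul_inv_cancel, mul_one]

/-- A word for the seesaw element that visits the right end first. -/
theorem seesawWord_right_first (l a : ℕ) :
    seesawWord l (a + 2) = ((x 1)⁻¹ * (x 0)⁻¹) ^ l * (x 0)⁻¹ * x 1 * x 0 * (x 1)⁻¹ * x 0 ^ l *
      x 0 ^ (a + 1) * x 1 * (x 0)⁻¹ ^ (a + 2) := by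
  rw [seesawWord_eq_tailWord, ← tailWord_conj (show 1 < a + 2 by omega),
    show a + 2 = 0 + 1 + (a + 1) by ring, tailWord_conj_pow, ← tailWord_one, zero_add,
    show 1 + (a + 1) - 1 = a + 1 by omega, inv_pow]
  group

/-! ### Positions as seen from the seesaw element -/

theorem action_joins_of_add_nonpos (j : ℕ) {z : ℚ} (h : z + j ≤ 0) :
    action (((x 1)⁻¹ * (x 0)⁻¹) ^ j) z = z + j := by
  induction j generalizing z with
  | zero => simp
  | succ j ih =>
    push_cast at h ⊢
    rw [pow_succ', map_mul, RelIso.mul_apply, ih (by linarith), map_mul, RelIso.mul_apply,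
      map_inv, map_inv, action_x_zero, action_x_one, shiftIso_inv_apply, halfIso_inv_apply, double,
      if_pos (by linarith)]
    ring

theorem action_joins_of_nonneg (j : ℕ) {z : ℚ} (h : 0 ≤ z) :
    action (((x 1)⁻¹ * (x 0)⁻¹) ^ j) z = z + 2 * j := by
  induction j generalizing z with
  | zero => simp
  | succ j ih =>
    push_cast
    rw [pow_succ', map_mul, RelIso.mul_apply, ih h, map_mul, RelIso.mul_apply,
      map_inv, map_inv, action_x_zero, action_x_one, shiftIso_inv_apply, halfIso_inv_apply, double]
    have : (0 : ℚ) ≤ j := by positivity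
    rw [if_neg (by linarith)]
    split_ifs <;> linarith

theorem action_joins_half (i j : ℕ) :
    action (((x 1)⁻¹ * (x 0)⁻¹) ^ (j + (1 + i))) (-(1 / 2) - i) = 1 + 2 * j := by
  rw [pow_add, map_mul, RelIso.mul_apply, pow_add, map_mul, RelIso.mul_apply,
    action_joins_of_add_nonpos i (by norm_num), pow_one, map_mul, RelIso.mul_apply, map_inv,
    map_inv, action_x_zero, action_x_one, shiftIso_inv_apply, halfIso_inv_apply,
    show double (-(1 / 2) - (i : ℚ) + i + 1) = 1 by rw [sub_add_cancel]; norm_num [double]]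
  rw [action_joins_of_nonneg j (by norm_num)]

theorem pos_seesawWord_eq (l a : ℕ) {c y z u v : ℚ}
    (hz : half (double (z - l) - 1) + 1 = y)
    (hy : action (((x 1)⁻¹ * (x 0)⁻¹) ^ l) y = u)
    (hu : half (u + (a + 1)) = v) (hv : v - a = c) :
    pos (seesawWord l (a + 1)) c = z := by
  rw [pos_eq_iff, seesawWord_left_first]
  simp only [map_mul, map_inv, map_pow, RelIso.mul_apply] at hy ⊢
  simp only [action_x_zero, action_x_one, shiftIso_pow_apply, halfIso_inv_apply, shiftIso_apply,
    shiftIso_inv_apply, shiftIso_inv_pow_apply, halfIso_apply] at hy ⊢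
  rw [hz, hy]
  push_cast
  rw [hu, hv]

theorem pos_seesawWord_even (l a j : ℕ) (hj : j ≤ l) (ha : 1 ≤ a) :
    pos (seesawWord l (a + 1)) (2 * j) = j := by
  have hj' : (j : ℚ) ≤ l := by exact_mod_cast hj
  have ha' : (1 : ℚ) ≤ a := by exact_mod_cast ha
  have hj0 : (0 : ℚ) ≤ j := by positivity
  refine pos_seesawWord_eq l a (y := j - l) (u := 2 * j) (v := 2 * j + a) ?_ ?_ ?_ ?_
  · rw [double, if_pos (by linarith), half, if_pos (by linarith)]; ring
  · obtain ⟨i, rfl⟩ := Nat.exists_eq_add_of_le hj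
    push_cast
    rw [pow_add, map_mul, RelIso.mul_apply,
      action_joins_of_add_nonpos i (by linarith), action_joins_of_nonneg j (by linarith)]
    ring
  · unfold half; split_ifs <;> linarith
  · ring

theorem pos_seesawWord_odd (l a j : ℕ) (hj : j ≤ l) (ha : 1 ≤ a) :
    pos (seesawWord l (a + 1)) (2 * j + 1) = j + 1 / 2 := by
  have hj' : (j : ℚ) ≤ l := by exact_mod_cast hj
  have ha' : (1 : ℚ) ≤ a := by exact_mod_cast ha
  have hj0 : (0 : ℚ) ≤ j := by positivity
  rcases hj.eq_or_lt with rfl | hlt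
  · refine pos_seesawWord_eq j a (y := 1) (u := 1 + 2 * j) (v := 2 * j + 1 + a) ?_ ?_ ?_ ?_
    · rw [show (j : ℚ) + 1 / 2 - j = 1 / 2 by ring]
      norm_num [double, half]
    · exact action_joins_of_nonneg j (by norm_num)
    · unfold half; split_ifs <;> linarith
    · ring
  · obtain ⟨i, rfl⟩ : ∃ i, l = j + (1 + i) := ⟨l - j - 1, by omega⟩
    have hi0 : (0 : ℚ) ≤ i := by positivity
    refine pos_seesawWord_eq _ a (y := -(1 / 2) - i) (u := 1 + 2 * j) (v := 2 * j + 1 + a)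
      ?_ (action_joins_half i j) ?_ ?_
    · push_cast
      rw [double, if_pos (by linarith), half, if_pos (by linarith)]; ring
    · unfold half; split_ifs <;> linarith
    · ring

theorem pos_seesawWord_right (l a : ℕ) (ha : 1 ≤ a) :
    pos (seesawWord l (a + 1)) (2 * l + 3 / 2) = l + 1 := by
  have ha' : (1 : ℚ) ≤ a := by exact_mod_cast ha
  have hl0 : (0 : ℚ) ≤ l := by positivity
  refine pos_seesawWord_eq l a (y := 3 / 2) (u := 3 / 2 + 2 * l) (v := 2 * l + 3 / 2 + a)
    ?_ ?_ ?_ ?_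
  · rw [show (l : ℚ) + 1 - l = 1 by ring]
    norm_num [double, half]
  · exact action_joins_of_nonneg l (by norm_num)
  · unfold half; split_ifs <;> linarith
  · ring

theorem action_left_eq (l : ℕ) {z : ℚ} (h : z ≤ 0) :
    half (double (z - l) - 1) + 1 = z - l ∧
      action (((x 1)⁻¹ * (x 0)⁻¹) ^ l) (z - l) = z := by
  have hl0 : (0 : ℚ) ≤ l := by positivity
  constructor
  · rw [double, if_pos (by linarith), half, if_pos (by linarith)]; ring
  · rw [action_joins_of_add_nonpos l (by linarith)]; ring

theorem pos_seesawWord_nonpos (l a j : ℕ) (hj : j + 1 ≤ a) :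
    pos (seesawWord l (a + 1)) (-j) = -j := by
  have hj' : (j : ℚ) + 1 ≤ a := by exact_mod_cast hj
  have hj0 : (0 : ℚ) ≤ j := by positivity
  obtain ⟨h1, h2⟩ := action_left_eq l (z := -j) (by linarith)
  refine pos_seesawWord_eq l a (v := -j + a) h1 h2 ?_ ?_
  · unfold half; split_ifs <;> linarith
  · ring

theorem pos_seesawWord_left (l a : ℕ) :
    pos (seesawWord l (a + 1)) (-a + 1 / 2) = -a := by
  have hj0 : (0 : ℚ) ≤ a := by positivity
  obtain ⟨h1, h2⟩ := action_left_eq l (z := -a) (by linarith)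
  refine pos_seesawWord_eq l a (v := 1 / 2) h1 h2 ?_ ?_
  · unfold half; split_ifs <;> linarith
  · ring

/-! ### Word length in Thompson's group -/

theorem dist_mul_le {g s : ThompsonF} (hs : s ∈ gens) :
    (SimpleGraph.mulCayley gens).Reachable g (g * s) ∧
      (SimpleGraph.mulCayley gens).dist g (g * s) ≤ 1 := by
  by_cases h : g = g * s
  · rw [← h]; simp
  · have : (SimpleGraph.mulCayley gens).Adj g (g * s) := by
      rw [SimpleGraph.mulCayley_adj']
      exact ⟨h, s, hs, Or.inl rfl⟩
    exact ⟨this.reachable, (SimpleGraph.dist_eq_one_iff_adj.2 this).le⟩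

theorem dist_mul_inv_le {g s : ThompsonF} (hs : s ∈ gens) :
    (SimpleGraph.mulCayley gens).Reachable g (g * s⁻¹) ∧
      (SimpleGraph.mulCayley gens).dist g (g * s⁻¹) ≤ 1 := by
  obtain ⟨h1, h2⟩ := dist_mul_le (g := g * s⁻¹) hs
  rw [inv_mul_cancel_right] at h1 h2
  exact ⟨h1.symm, by rwa [SimpleGraph.dist_comm]⟩

theorem reachable_one (g : ThompsonF) : (SimpleGraph.mulCayley gens).Reachable 1 g := by
  have hg : g ∈ Subgroup.closure gens := by rw [closure_gens]; trivial
  induction hg using Subgroup.closure_induction_right with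
  | one => exact SimpleGraph.Reachable.refl _
  | mul_right g _ s hs ih => exact ih.trans (dist_mul_le hs).1
  | mul_inv_cancel g _ s hs ih => exact ih.trans (dist_mul_inv_le hs).1

theorem connected : (SimpleGraph.mulCayley gens).Connected :=
  (SimpleGraph.connected_iff_exists_forall_reachable _).2 ⟨1, reachable_one⟩

theorem wordLength_mul_le (g : ThompsonF) {s : ThompsonF} (hs : s ∈ gens) :
    wordLength gens (g * s) ≤ wordLength gens g + 1 :=
  (connected.dist_triangle (v := g)).trans (Nat.add_le_add_left (dist_mul_le hs).2 _)

theorem wordLength_mul_inv_le (g : ThompsonF) {s : ThompsonF} (hs : s ∈ gens) :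
    wordLength gens (g * s⁻¹) ≤ wordLength gens g + 1 :=
  (connected.dist_triangle (v := g)).trans (Nat.add_le_add_left (dist_mul_inv_le hs).2 _)

theorem wordLength_mul_pow_le (g s : ThompsonF) (b : ℕ)
    (hs : ∀ g, wordLength gens (g * s) ≤ wordLength gens g + b) (k : ℕ) :
    wordLength gens (g * s ^ k) ≤ wordLength gens g + k * b := by
  induction k with
  | zero => simp
  | succ k ih =>
    rw [pow_succ, ← mul_assoc]
    have := hs (g * s ^ k)
    have e : (k + 1) * b = k * b + b := by ring
    omega

theorem x_zero_mem : x 0 ∈ gens := by simp [gens]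

theorem x_one_mem : x 1 ∈ gens := by simp [gens]

theorem wordLength_mul_x_zero_pow_le (g : ThompsonF) (k : ℕ) :
    wordLength gens (g * x 0 ^ k) ≤ wordLength gens g + k := by
  simpa using wordLength_mul_pow_le g (x 0) 1 (fun g => wordLength_mul_le g x_zero_mem) k

theorem wordLength_mul_x_zero_inv_pow_le (g : ThompsonF) (k : ℕ) :
    wordLength gens (g * (x 0)⁻¹ ^ k) ≤ wordLength gens g + k := by
  simpa using wordLength_mul_pow_le g (x 0)⁻¹ 1 (fun g => wordLength_mul_inv_le g x_zero_mem) k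

theorem wordLength_mul_joins_le (g : ThompsonF) (k : ℕ) :
    wordLength gens (g * ((x 1)⁻¹ * (x 0)⁻¹) ^ k) ≤ wordLength gens g + k * 2 := by
  refine wordLength_mul_pow_le g _ 2 (fun g => ?_) k
  have h1 := wordLength_mul_inv_le g x_one_mem
  have h2 := wordLength_mul_inv_le (g * (x 1)⁻¹) x_zero_mem
  rw [← mul_assoc]
  omega

theorem wordLength_one : wordLength gens 1 = 0 := SimpleGraph.dist_self

theorem wordLength_seesawWord_mul_inv_pow_le (l a i : ℕ) (hi : i ≤ l) :
    wordLength gens (seesawWord l (a + 1) * (x 0)⁻¹ ^ i) + i ≤ 2 * a + 3 * l + 6 := by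
  obtain ⟨j, rfl⟩ := Nat.exists_eq_add_of_le' hi
  rw [inv_pow (x 0) i, seesawWord_left_first, pow_add (x 0) j i, ← mul_assoc (_ * _) (x 0 ^ j),
    mul_inv_cancel_right, ← one_mul (x 0 ^ a)]
  have h1 := wordLength_mul_x_zero_pow_le 1 a
  have h2 := wordLength_mul_le (1 * x 0 ^ a) x_one_mem
  generalize 1 * x 0 ^ a * x 1 = g at *
  have h3 := wordLength_mul_x_zero_inv_pow_le g (a + 1)
  generalize g * (x 0)⁻¹ ^ (a + 1) = g at *
  have h4 := wordLength_mul_joins_le g (j + i)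
  generalize g * ((x 1)⁻¹ * (x 0)⁻¹) ^ (j + i) = g at *
  have h5 := wordLength_mul_inv_le g x_zero_mem
  have h6 := wordLength_mul_le (g * (x 0)⁻¹) x_one_mem
  have h7 := wordLength_mul_le (g * (x 0)⁻¹ * x 1) x_zero_mem
  have h8 := wordLength_mul_inv_le (g * (x 0)⁻¹ * x 1 * x 0) x_one_mem
  have h9 := wordLength_mul_x_zero_pow_le (g * (x 0)⁻¹ * x 1 * x 0 * (x 1)⁻¹) j
  rw [wordLength_one] at h1
  omega

theorem wordLength_seesawWord_mul_pow_le (l a i : ℕ) (hi : i ≤ a + 2) :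
    wordLength gens (seesawWord l (a + 2) * x 0 ^ i) + i ≤ 2 * a + 3 * l + 8 := by
  obtain ⟨j, hj⟩ := Nat.exists_eq_add_of_le' hi
  rw [seesawWord_right_first, hj, pow_add (x 0)⁻¹ j i, inv_pow (x 0) i,
    ← mul_assoc (_ * _) ((x 0)⁻¹ ^ j), inv_mul_cancel_right,
    ← one_mul (((x 1)⁻¹ * (x 0)⁻¹) ^ l)]
  have h1 := wordLength_mul_joins_le 1 l
  generalize 1 * ((x 1)⁻¹ * (x 0)⁻¹) ^ l = g at *
  have h5 := wordLength_mul_inv_le g x_zero_mem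
  have h6 := wordLength_mul_le (g * (x 0)⁻¹) x_one_mem
  have h7 := wordLength_mul_le (g * (x 0)⁻¹ * x 1) x_zero_mem
  have h8 := wordLength_mul_inv_le (g * (x 0)⁻¹ * x 1 * x 0) x_one_mem
  generalize g * (x 0)⁻¹ * x 1 * x 0 * (x 1)⁻¹ = g' at *
  have h9 := wordLength_mul_x_zero_pow_le g' l
  generalize g' * x 0 ^ l = g' at *
  have h2 := wordLength_mul_x_zero_pow_le g' (a + 1)
  have h3 := wordLength_mul_le (g' * x 0 ^ (a + 1)) x_one_mem
  have h4 := wordLength_mul_x_zero_inv_pow_le (g' * x 0 ^ (a + 1) * x 1) j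
  rw [wordLength_one] at h1
  omega

theorem exists_steps (g : ThompsonF) : ∃ f : ℕ → ThompsonF, f 0 = 1 ∧ f (wordLength gens g) = g ∧
    ∀ t < wordLength gens g, Step (f t) (f (t + 1)) := by
  obtain ⟨p, hp⟩ := (reachable_one g).exists_walk_length_eq_dist
  refine ⟨p.getVert, p.getVert_zero, ?_, fun t ht => ?_⟩
  · rw [wordLength, ← hp, p.getVert_length]
  · exact step_of_adj (p.adj_getVert_succ (by rwa [hp]))

/-! ### Total variation of zones along a path -/

/-- The total variation of the zone of `c` along the first `L` steps of `f`. -/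
noncomputable def variation (f : ℕ → ThompsonF) (L : ℕ) (c : ℚ) : ℤ :=
  ∑ t ∈ Finset.range L, |zone (pos (f (t + 1)) c) - zone (pos (f t) c)|

theorem sum_variation_le {f : ℕ → ThompsonF} {L : ℕ} (hs : ∀ t < L, Step (f t) (f (t + 1)))
    (T : Finset ℚ) : ∑ c ∈ T, variation f L c ≤ L := by
  unfold variation
  rw [Finset.sum_comm]
  calc _ ≤ ∑ t ∈ Finset.range L, (1 : ℤ) := by
        refine Finset.sum_le_sum fun t ht => ?_
        obtain ⟨d, hd⟩ := (hs t (Finset.mem_range.1 ht)).zone_change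
        refine (Finset.sum_le_sum fun c _ => hd c).trans ?_
        rw [Finset.sum_ite_eq']
        split_ifs <;> simp
    _ = L := by simp

theorem abs_sub_le_sum_Ico (z : ℕ → ℤ) {a b : ℕ} (h : a ≤ b) :
    |z b - z a| ≤ ∑ t ∈ Finset.Ico a b, |z (t + 1) - z t| := by
  rw [← Finset.sum_Ico_sub z h]
  exact Finset.abs_sum_le_sum_abs _ _

theorem variation_ge₂ (f : ℕ → ThompsonF) {L s t : ℕ} (c : ℚ) (h : s ≤ t) (ht : t ≤ L) :
    |zone (pos (f s) c) - zone (pos (f 0) c)| + |zone (pos (f t) c) - zone (pos (f s) c)| +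
      |zone (pos (f L) c) - zone (pos (f t) c)| ≤ variation f L c := by
  have h1 := abs_sub_le_sum_Ico (fun t => zone (pos (f t) c)) (Nat.zero_le s)
  have h2 := abs_sub_le_sum_Ico (fun t => zone (pos (f t) c)) h
  have h3 := abs_sub_le_sum_Ico (fun t => zone (pos (f t) c)) ht
  rw [variation, Finset.range_eq_Ico, ← Finset.sum_Ico_consecutive _ (Nat.zero_le t) ht,
    ← Finset.sum_Ico_consecutive _ (Nat.zero_le s) h]
  linarith

theorem variation_ge₁ (f : ℕ → ThompsonF) {L t : ℕ} (c : ℚ) (ht : t ≤ L) :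
    |zone (pos (f t) c) - zone (pos (f 0) c)| + |zone (pos (f L) c) - zone (pos (f t) c)| ≤
      variation f L c := by
  simpa using variation_ge₂ f c le_rfl ht

theorem variation_ge (f : ℕ → ThompsonF) (L : ℕ) (c : ℚ) :
    |zone (pos (f L) c) - zone (pos (f 0) c)| ≤ variation f L c := by
  simpa using variation_ge₁ f c (Nat.zero_le L)

theorem sum_range_odd_even (F : ℕ → ℤ) (l : ℕ) :
    ∑ j ∈ Finset.range (2 * l + 1), F j =
      F 0 + ∑ i ∈ Finset.range l, (F (2 * i + 1) + F (2 * i + 2)) := by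
  induction l with
  | zero => simp
  | succ l ih =>
    rw [show 2 * (l + 1) + 1 = 2 * l + 1 + 1 + 1 by ring, Finset.sum_range_succ,
      Finset.sum_range_succ, ih, Finset.sum_range_succ]
    ring

theorem not_int_ne {z : ℚ} (h : zone z = 2) (n : ℤ) : z ≠ n := by
  intro h'
  rcases le_or_gt n 0 with hn | hn
  · have := zone_of_nonpos n h' hn; omega
  · have := zone_of_pos n h' hn; omega

/-- The points whose zones have to change along a path to a seesaw word. -/
theorem tracked_sum_le {f : ℕ → ThompsonF} {L : ℕ} (hs : ∀ t < L, Step (f t) (f (t + 1)))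
    (l a : ℕ) {d : ℚ} (hd : zone d = 2) (hd1 : d ≠ 2 * l + 7 / 2) (hd2 : d ≠ -a + 1 / 2) :
    variation f L 1 + ∑ i ∈ Finset.range l, (variation f L (2 * i + 2) + variation f L (2 * i + 3)) +
      (variation f L (2 * l + 2) + variation f L (2 * l + 3)) +
      ∑ j ∈ Finset.range a, variation f L (-j) +
      variation f L (2 * l + 7 / 2) + variation f L (-a + 1 / 2) + variation f L d ≤ L := by
  classical
  set T₁ : Finset ℚ := (Finset.range (2 * (l + 1) + 1)).image (fun j : ℕ => (j : ℚ) + 1) with hT₁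
  set T₂ : Finset ℚ := (Finset.range a).image (fun j : ℕ => -(j : ℚ)) with hT₂
  have hi : ∀ c ∈ T₁ ∪ T₂, ∃ n : ℤ, c = n := by
    intro c hc
    rcases Finset.mem_union.1 hc with hc | hc <;> obtain ⟨j, -, rfl⟩ := Finset.mem_image.1 hc
    · exact ⟨j + 1, by push_cast; rfl⟩
    · exact ⟨-j, by push_cast; rfl⟩
  have hzR : zone (2 * (l : ℚ) + 7 / 2) = 2 :=
    zone_of_not_int (2 * l + 3) (by push_cast; linarith) (by push_cast; linarith)
  have hzL : zone (-(a : ℚ) + 1 / 2) = 2 :=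
    zone_of_not_int (-a) (by push_cast; linarith) (by push_cast; linarith)
  have hni : ∀ c, zone c = 2 → c ∉ T₁ ∪ T₂ := fun c hc h => by
    obtain ⟨n, hn⟩ := hi c h
    exact not_int_ne hc n hn
  have hLR : -(a : ℚ) + 1 / 2 ≠ 2 * l + 7 / 2 := by
    have : (0 : ℚ) ≤ a := by positivity
    have : (0 : ℚ) ≤ l := by positivity
    intro h; linarith
  have hdisj : Disjoint T₁ T₂ := by
    rw [Finset.disjoint_left]
    intro c h1 h2
    obtain ⟨i, -, rfl⟩ := Finset.mem_image.1 h1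
    obtain ⟨j, -, h⟩ := Finset.mem_image.1 h2
    have : (0 : ℚ) ≤ i := by positivity
    have : (0 : ℚ) ≤ j := by positivity
    linarith
  have key := sum_variation_le hs
    (insert d (insert (-(a : ℚ) + 1 / 2) (insert (2 * (l : ℚ) + 7 / 2) (T₁ ∪ T₂))))
  rw [Finset.sum_insert, Finset.sum_insert, Finset.sum_insert (hni _ hzR),
    Finset.sum_union hdisj, hT₁, hT₂, Finset.sum_image, Finset.sum_image, sum_range_odd_even,
    Finset.sum_range_succ] at key
  · have e1 : ∀ i : ℕ, ((2 * i + 1 : ℕ) : ℚ) + 1 = 2 * i + 2 := fun i => by push_cast; ring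
    have e2 : ∀ i : ℕ, ((2 * i + 2 : ℕ) : ℚ) + 1 = 2 * i + 3 := fun i => by push_cast; ring
    simp only [e1, e2, Nat.cast_zero, zero_add] at key
    linarith
  · intro i _ j _ h
    simpa using h
  · intro i _ j _ h
    simpa using h
  · simp only [Finset.mem_insert, not_or]
    exact ⟨hLR, hni _ hzL⟩
  · simp only [Finset.mem_insert, not_or]
    exact ⟨hd2, hd1, hni _ hd⟩

/-! ### Forced events along a path -/

theorem dyadic_or_split {f : ℕ → ThompsonF} {L : ℕ} (hs : ∀ t < L, Step (f t) (f (t + 1)))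
    {s : ℕ} (hsL : s ≤ L) {p q r : ℚ} (h : Dyadic (pos (f s) p) (pos (f s) q) (pos (f s) r)) :
    Dyadic (pos (f L) p) (pos (f L) q) (pos (f L) r) ∨
      ∃ t, s ≤ t ∧ t < L ∧ pos (f t) p = 0 ∧ pos (f t) r = 1 ∧ pos (f (t + 1)) q = 1 := by
  induction L, hsL using Nat.le_induction with
  | base => exact Or.inl h
  | succ L hL ih =>
    rcases ih fun t ht => hs t (by omega) with h | ⟨t, h1, h2, h3⟩
    · rcases (hs L (by omega)).dyadic h with h | ⟨h1, h2, h3, h4⟩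
      · exact Or.inl h
      · exact Or.inr ⟨L, hL, by omega, h1, h3, h4⟩
    · exact Or.inr ⟨t, h1, by omega, h3⟩

theorem exists_split {f : ℕ → ThompsonF} {L : ℕ} (hs : ∀ t < L, Step (f t) (f (t + 1)))
    (h0 : f 0 = 1) {p q r : ℚ} (h : Dyadic p q r) (hq : zone (pos (f L) q) ≠ 2) :
    ∃ t ≤ L, pos (f t) p = 0 ∧ pos (f t) r = 1 := by
  rcases dyadic_or_split hs (Nat.zero_le L) (p := p) (q := q) (r := r) (by
    simpa only [h0, pos_one] using h) with h | ⟨t, -, h1, h2, h3, -⟩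
  · exact absurd h.not_int hq
  · exact ⟨t, h1.le, h2, h3⟩

/-- The only way for a point to become a non-integer. -/
theorem Step.join {g g' : ThompsonF} (h : Step g g') {c : ℚ} (h1 : zone (pos g c) ≠ 2)
    (h2 : zone (pos g' c) = 2) : pos g c = 1 ∧ pos g' c = 1 / 2 := by
  have z0 : zone 0 = 0 := zone_of_nonpos 0 (by norm_num) le_rfl
  have z1 : zone 1 = 1 := zone_of_pos 1 (by norm_num) le_rfl
  rcases h with rfl | rfl | rfl | rfl
  · rw [pos_mul_x_zero] at h2
    by_cases h : pos g c = 0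
    · rw [h, zero_add, z1] at h2; omega
    · rw [zone_add_one h] at h2; omega
  · rw [pos_mul_x_zero_inv] at h2
    by_cases h : pos g c - 1 = 0
    · rw [h, z0] at h2; omega
    · rw [← zone_add_one h, sub_add_cancel] at h2; omega
  · rw [pos_mul_x_one] at h2
    by_cases h : pos g c = 1 / 2
    · exfalso
      rw [h, show double (1 / 2) = 1 by norm_num [double], z1] at h2; omega
    · rw [zone_double h] at h2; omega
  · rw [pos_mul_x_one_inv] at h2 ⊢
    by_cases h : half (pos g c) = 1 / 2
    · refine ⟨?_, h⟩
      rw [← double_half (pos g c), h]; norm_num [double]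
    · rw [← zone_double h, double_half] at h2; omega

theorem exists_join {f : ℕ → ThompsonF} {L : ℕ} (hs : ∀ t < L, Step (f t) (f (t + 1)))
    {c : ℚ} (h0 : zone (pos (f 0) c) ≠ 2) (hL : zone (pos (f L) c) = 2) :
    ∃ t < L, pos (f t) c = 1 ∧ pos (f (t + 1)) c = 1 / 2 := by
  induction L with
  | zero => exact absurd hL h0
  | succ L ih =>
    by_cases h : zone (pos (f L) c) = 2
    · obtain ⟨t, ht, h⟩ := ih (fun t ht => hs t (by omega)) h
      exact ⟨t, by omega, h⟩
    · exact ⟨L, by omega, (hs L (by omega)).join h hL⟩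

theorem zone_nonneg (z : ℚ) : 0 ≤ zone z := by
  rcases zone_cases z with ⟨n, -, -, e⟩ | ⟨n, -, -, e⟩ | ⟨n, -, -, e⟩ <;> omega

theorem zone_le (z : ℚ) : zone z ≤ 2 := by
  rcases zone_cases z with ⟨n, -, -, e⟩ | ⟨n, -, -, e⟩ | ⟨n, -, -, e⟩ <;> omega

theorem zone_ne_one {z : ℚ} (h : z ≤ 0) : zone z ≠ 1 := by
  rcases zone_cases z with ⟨n, -, -, e⟩ | ⟨n, rfl, hn, -⟩ | ⟨n, -, -, e⟩
  · omega
  · have : n ≤ 0 := by exact_mod_cast h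
    omega
  · omega

theorem zone_ne_zero {z : ℚ} (h : 0 < z) : zone z ≠ 0 := by
  rcases zone_cases z with ⟨n, rfl, hn, -⟩ | ⟨n, -, -, e⟩ | ⟨n, -, -, e⟩
  · have : 0 < n := by exact_mod_cast h
    omega
  · omega
  · omega

/-- Joining at `c` before the join at `c + 1` cannot be done for free. -/
theorem variation_of_join {f : ℕ → ThompsonF} {L : ℕ} (hs : ∀ t < L, Step (f t) (f (t + 1)))
    (h0 : f 0 = 1) {c n : ℤ} (hc : 1 ≤ c) (h1 : pos (f L) c = n + 1 / 2)
    (h2 : pos (f L) (c + 1) = n + 3 / 4) :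
    3 ≤ variation f L c ∨ 3 ≤ variation f L (c + 1) ∨
      ∃ d : ℚ, (c : ℚ) < d ∧ d < c + 1 ∧ 1 ≤ variation f L d := by
  have zc : zone (pos (f 0) c) = 1 := by rw [h0, pos_one]; exact zone_of_pos c rfl hc
  have zc' : zone (pos (f 0) (c + 1)) = 1 := by
    rw [h0, pos_one]; exact zone_of_pos (c + 1) (by push_cast; rfl) (by omega)
  have ze : zone (pos (f L) c) = 2 := by
    rw [h1]; exact zone_of_not_int n (by linarith) (by linarith)
  have ze' : zone (pos (f L) (c + 1)) = 2 := by
    rw [h2]; exact zone_of_not_int n (by linarith) (by linarith)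
  obtain ⟨t, ht, j1, j2⟩ := exists_join hs (c := c + 1) (by omega) ze'
  have hlt : pos (f t) c < 1 := by
    rw [← j1]; exact pos_strictMono _ (by linarith)
  rcases lt_trichotomy (pos (f t) c) 0 with h | h | h
  · right; right
    have e : pos (f t) (action (f t) 0) = 0 := (pos_eq_iff _ _ _).2 rfl
    refine ⟨action (f t) 0, ?_, ?_, ?_⟩
    · rw [← (pos_strictMono (f t)).lt_iff_lt, e]; exact h
    · rw [← (pos_strictMono (f t)).lt_iff_lt, e, j1]; norm_num
    · have d1 : (c : ℚ) < action (f t) 0 := by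
        rw [← (pos_strictMono (f t)).lt_iff_lt, e]; exact h
      have d2 : action (f t) 0 < (c : ℚ) + 1 := by
        rw [← (pos_strictMono (f t)).lt_iff_lt, e, j1]; norm_num
      have := variation_ge₁ f (action (f t) 0) ht.le
      rw [e, h0, pos_one, zone_of_not_int c d1 d2, zone_of_nonpos 0 (by norm_num) le_rfl] at this
      have h3 := abs_nonneg (zone (pos (f L) (action (f t) 0)) - 0)
      rw [show |(0 : ℤ) - 2| = 2 from rfl] at this
      linarith
  · left
    have := variation_ge₁ f c ht.le
    rw [h, zc, ze, zone_of_nonpos 0 (by norm_num) le_rfl] at this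
    norm_num at this
    omega
  · right; left
    have e0 : pos (f (t + 1)) (action (f (t + 1)) 0) = 0 := (pos_eq_iff _ _ _).2 rfl
    have e1 : pos (f (t + 1)) (action (f (t + 1)) 1) = 1 := (pos_eq_iff _ _ _).2 rfl
    have hpos : 0 < pos (f (t + 1)) c := by
      rcases hs t ht with h' | h' | h' | h' <;> rw [h'] at j2 ⊢
      · rw [pos_mul_x_zero]; linarith
      · rw [pos_mul_x_zero_inv, j1] at j2; norm_num at j2
      · rw [pos_mul_x_one, j1] at j2; norm_num [double] at j2
      · rw [pos_mul_x_one_inv]; unfold half; split_ifs <;> linarith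
    rcases dyadic_or_split hs (s := t + 1) ht (p := action (f (t + 1)) 0) (q := c + 1)
      (r := action (f (t + 1)) 1) (by
        rw [e0, e1, j2]; exact ⟨0, 0, by norm_num, by norm_num, by norm_num⟩) with
      ⟨k, b, b1, b2, -⟩ | ⟨s, hs1, hs2, -, -, hs3⟩
    · exfalso
      have hlt : pos (f L) (action (f (t + 1)) 0) < pos (f L) c := by
        apply pos_strictMono
        rw [← (pos_strictMono (f (t + 1))).lt_iff_lt, e0]; exact hpos
      rw [b1, h1] at hlt
      rw [h2] at b2
      rcases k with _ | _ | k
      · norm_num at b2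
        have : (4 * n + 1 : ℚ) = 4 * b := by linarith
        norm_cast at this
        omega
      · norm_num at b2 hlt
        have : (2 * n + 1 : ℚ) = b := by linarith
        linarith
      · rw [eq_div_iff (by positivity)] at b2
        have : (2 * ((4 * n + 3) * 2 ^ k) : ℚ) = 2 * b + 1 := by
          rw [← b2, pow_succ, pow_succ, pow_succ]; ring
        norm_cast at this
        omega
    · have := variation_ge₂ f (s := t + 1) (t := s + 1) (c + 1) (by omega) hs2
      rw [hs3, j2, zc', ze', zone_of_pos (z := 1) 1 (by norm_num) le_rfl,
        zone_of_not_int (z := 1 / 2) 0 (by norm_num) (by norm_num)] at this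
      norm_num at this
      omega

/-! ### Lower bounds for the word length -/

/-- The zones, as seen from `g`, of the points whose zones have to change. -/
structure Profile (l a : ℕ) (g : ThompsonF) : Prop where
  odd : ∀ i ≤ l, zone (pos g (2 * i + 1)) ≠ 0
  last : zone (pos g (2 * l + 3)) = 2
  nonpos : ∀ j < a, zone (pos g (-j)) ≠ 1
  right : zone (pos g (2 * l + 7 / 2)) = 1
  left : zone (pos g (-a + 1 / 2)) = 0

theorem Profile.variation_bounds {l a : ℕ} {f : ℕ → ThompsonF} {L : ℕ}
    (h : Profile l a (f L)) (h0 : f 0 = 1) (hs : ∀ t < L, Step (f t) (f (t + 1))) :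
    (∀ i ≤ l, 1 ≤ variation f L (2 * i + 1)) ∧ 3 ≤ variation f L (2 * l + 3) ∧
      (∀ j < a, 2 ≤ variation f L (-j)) ∧ 1 ≤ variation f L (2 * l + 7 / 2) ∧
      2 ≤ variation f L (-a + 1 / 2) ∧
      (∀ i ≤ l, zone (pos (f L) (2 * i + 2)) = 1 → 2 ≤ variation f L (2 * i + 2)) := by
  obtain ⟨t, ht, r1, r2⟩ := exists_split hs h0 (p := 2 * l + 3) (q := 2 * l + 7 / 2)
    (r := 2 * l + 4) ⟨0, 2 * l + 3, by push_cast; ring, by push_cast; ring, by push_cast; ring⟩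
    (by rw [h.right]; norm_num)
  obtain ⟨s, hsL, l1, l2⟩ := exists_split hs h0 (p := -a) (q := -a + 1 / 2)
    (r := -a + 1) ⟨0, -a, by push_cast; ring, by push_cast; ring, by push_cast; ring⟩
    (by rw [h.left]; norm_num)
  have hR : ∀ c : ℚ, c ≤ 2 * l + 3 → zone (pos (f t) c) ≠ 1 := fun c hc =>
    zone_ne_one (by rw [← r1]; exact (pos_strictMono _).monotone hc)
  have hpositive : ∀ i : ℕ, zone (pos (f 0) (i + 1)) = 1 := fun i => by
    rw [h0, pos_one]; exact zone_of_pos (i + 1) (by push_cast; rfl) (by omega)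
  have key : ∀ i : ℕ, i ≤ 2 * l + 1 → zone (pos (f L) (i + 1)) = 1 →
      2 ≤ variation f L (i + 1) := by
    intro i hi he
    have h1 := variation_ge₁ f (i + 1) ht
    have h2 := hR (i + 1) (by
      have : (i : ℚ) ≤ 2 * l + 1 := by exact_mod_cast hi
      linarith)
    rw [he, hpositive i] at h1
    have e1 := neg_abs_le (zone (pos (f t) (i + 1)) - 1)
    have e2 := le_abs_self (zone (pos (f t) (i + 1)) - 1)
    have e3 := neg_abs_le (1 - zone (pos (f t) (i + 1)))
    have e4 := le_abs_self (1 - zone (pos (f t) (i + 1)))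
    omega
  refine ⟨fun i hi => ?_, ?_, fun j hj => ?_, ?_, ?_, fun i hi he => ?_⟩
  · have h1 := h.odd i hi
    by_cases he : zone (pos (f L) (2 * i + 1)) = 1
    · have := key (2 * i) (by omega) (by push_cast; exact he)
      push_cast at this
      omega
    · have h2 := variation_ge f L (2 * i + 1)
      have h3 := hpositive (2 * i)
      push_cast at h3
      rw [h3] at h2
      have := zone_nonneg (pos (f L) (2 * i + 1))
      have := le_abs_self (zone (pos (f L) (2 * i + 1)) - 1)
      omega
  · have h1 := variation_ge₁ f (2 * l + 3) ht
    have h3 := hpositive (2 * l + 2)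
    push_cast at h3
    rw [show (2 * (l : ℚ) + 2 + 1) = 2 * l + 3 by ring] at h3
    rw [r1, h.last, h3, zone_of_nonpos 0 (by norm_num) le_rfl] at h1
    norm_num at h1
    omega
  · have h1 := variation_ge₁ f (-j) hsL
    have h2 : zone (pos (f s) (-j)) ≠ 0 := zone_ne_zero (by
      have : (j : ℚ) + 1 ≤ a := by exact_mod_cast hj
      have := (pos_strictMono (f s)).monotone (show -(a : ℚ) + 1 ≤ -j by linarith)
      linarith)
    have h3 := h.nonpos j hj
    have h4 : zone (pos (f 0) (-j)) = 0 := by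
      rw [h0, pos_one]; exact zone_of_nonpos (-j) (by push_cast; rfl) (by omega)
    rw [h4] at h1
    have := zone_nonneg (pos (f s) (-j))
    have := zone_nonneg (pos (f L) (-j))
    have e1 := le_abs_self (zone (pos (f s) (-j)) - 0)
    have e2 := le_abs_self (zone (pos (f L) (-j)) - zone (pos (f s) (-j)))
    have e3 := neg_abs_le (zone (pos (f L) (-j)) - zone (pos (f s) (-j)))
    omega
  · have h1 := variation_ge f L (2 * l + 7 / 2)
    rw [h.right, h0, pos_one, zone_of_not_int (2 * l + 3) (by push_cast; linarith)
      (by push_cast; linarith)] at h1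
    norm_num at h1
    omega
  · have h1 := variation_ge f L (-a + 1 / 2)
    rw [h.left, h0, pos_one, zone_of_not_int (-a) (by push_cast; linarith)
      (by push_cast; linarith)] at h1
    norm_num at h1
    omega
  · have := key (2 * i + 1) (by omega) (by
      push_cast; rw [show (2 * (i : ℚ) + 1 + 1) = 2 * i + 2 by ring]; exact he)
    push_cast at this
    rwa [show (2 * (i : ℚ) + 1 + 1) = 2 * i + 2 by ring] at this

theorem Profile.le_of_pairs {l a : ℕ} {f : ℕ → ThompsonF} {L : ℕ}
    (h : Profile l a (f L)) (h0 : f 0 = 1) (hs : ∀ t < L, Step (f t) (f (t + 1)))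
    {d : ℚ} (hd : zone d = 2) (hd1 : d ≠ 2 * l + 7 / 2) (hd2 : d ≠ -a + 1 / 2)
    (he : zone (pos (f L) (2 * l + 2)) = 1) {S : ℤ}
    (hS : S ≤ ∑ i ∈ Finset.range l, (variation f L (2 * i + 2) + variation f L (2 * i + 3))) :
    S + 2 * a + 9 + variation f L d ≤ L := by
  obtain ⟨b1, b2, b3, b4, b5, b6⟩ := h.variation_bounds h0 hs
  have h1 := tracked_sum_le hs l a hd hd1 hd2
  have h2 : ∑ j ∈ Finset.range a, (2 : ℤ) ≤ ∑ j ∈ Finset.range a, variation f L (-j) :=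
    Finset.sum_le_sum fun j hj => b3 j (Finset.mem_range.1 hj)
  rw [Finset.sum_const, Finset.card_range, nsmul_eq_mul] at h2
  have h3 := b1 0 (Nat.zero_le l)
  rw [Nat.cast_zero, mul_zero, zero_add] at h3
  have h4 := b6 l le_rfl he
  linarith

theorem Profile.le_wordLength {l a : ℕ} {g : ThompsonF} (h : Profile l a g)
    (he : ∀ i ≤ l, zone (pos g (2 * i + 2)) = 1)
    {d : ℚ} (hd : zone d = 2) (hd1 : d ≠ 2 * l + 7 / 2) (hd2 : d ≠ -a + 1 / 2) :
    3 * l + 2 * a + 9 + (2 - zone (pos g d)) ≤ wordLength gens g := by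
  obtain ⟨f, h0, hL, hs⟩ := exists_steps g
  rw [← hL] at h he
  obtain ⟨b1, b2, b3, b4, b5, b6⟩ := h.variation_bounds h0 hs
  have h1 := h.le_of_pairs h0 hs hd hd1 hd2 (he l le_rfl) (S := 3 * l) (by
    rw [show (3 * l : ℤ) = ∑ i ∈ Finset.range l, (3 : ℤ) by simp [mul_comm]]
    refine Finset.sum_le_sum fun i hi => ?_
    have hi := Finset.mem_range.1 hi
    have h1 := b6 i hi.le (he i hi.le)
    have h2 := b1 (i + 1) hi
    push_cast at h2
    rw [show (2 * ((i : ℚ) + 1) + 1) = 2 * i + 3 by ring] at h2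
    linarith)
  have h2 := variation_ge f (wordLength gens g) d
  rw [h0, pos_one, hd, hL] at h2
  have := neg_abs_le (zone (pos g d) - 2)
  linarith

theorem Profile.le_wordLength_of_join {l a n : ℕ} {g : ThompsonF} (h : Profile l a g)
    (hn : n < l) (he : ∀ i ≤ l, i ≠ n → zone (pos g (2 * i + 2)) = 1)
    (h1 : pos g (2 * n + 2) = n + 1 / 2) (h2 : pos g (2 * n + 3) = n + 3 / 4) :
    3 * l + 2 * a + 9 ≤ (wordLength gens g : ℤ) := by
  obtain ⟨f, h0, hL, hs⟩ := exists_steps g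
  have h12 := variation_of_join hs h0 (c := 2 * n + 2) (n := n) (by omega) (by
    rw [hL]; push_cast; exact h1) (by
    rw [hL]; push_cast; rw [show 2 * (n : ℚ) + 2 + 1 = 2 * n + 3 by ring]; exact h2)
  push_cast at h12
  rw [show 2 * (n : ℚ) + 2 + 1 = 2 * n + 3 by ring] at h12
  rw [← hL] at h he h1
  generalize wordLength gens g = L at *
  obtain ⟨b1, b2, b3, b4, b5, b6⟩ := h.variation_bounds h0 hs
  have c1 : ∀ i < l, 1 ≤ variation f L (2 * i + 3) := by
    intro i hi
    have h2 := b1 (i + 1) hi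
    push_cast at h2
    rwa [show (2 * ((i : ℚ) + 1) + 1) = 2 * i + 3 by ring] at h2
  have c2 : ∀ i < l, i ≠ n → 3 ≤ variation f L (2 * i + 2) + variation f L (2 * i + 3) := by
    intro i hi hin
    have := c1 i hi
    have := b6 i hi.le (he i hi.le hin)
    linarith
  have c3 : 1 ≤ variation f L (2 * n + 2) := by
    have h2 := variation_ge f L (2 * n + 2)
    rw [h1, h0, pos_one, zone_of_not_int n (by push_cast; linarith) (by push_cast; linarith),
      zone_of_pos (2 * n + 2) (by push_cast; rfl) (by omega)] at h2
    norm_num at h2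
    omega
  have c4 := c1 n hn
  have hel := he l le_rfl (by omega)
  have hn' : (n : ℚ) + 1 ≤ l := by exact_mod_cast hn
  have hn0 : (0 : ℚ) ≤ n := by positivity
  have ha0 : (0 : ℚ) ≤ a := by positivity
  by_cases h3 : 3 ≤ variation f L (2 * n + 2) + variation f L (2 * n + 3)
  · have := h.le_of_pairs h0 hs (d := 1 / 3) (zone_of_not_int 0 (by norm_num) (by norm_num))
      (by intro h'; linarith)
      (by
        intro h'
        have : (6 * a : ℚ) = 1 := by linarith
        norm_cast at this
        omega) hel (S := 3 * l) (by
      rw [show (3 * l : ℤ) = ∑ i ∈ Finset.range l, (3 : ℤ) by simp [mul_comm]]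
      refine Finset.sum_le_sum fun i hi => ?_
      by_cases hin : i = n
      · rw [hin]; exact h3
      · exact c2 i (Finset.mem_range.1 hi) hin)
    have := variation_ge f L (1 / 3)
    have := abs_nonneg (zone (pos (f L) (1 / 3)) - zone (pos (f 0) (1 / 3)))
    linarith
  · obtain ⟨d, d1, d2, d3⟩ : ∃ d : ℚ, 2 * (n : ℚ) + 2 < d ∧ d < 2 * n + 3 ∧
        1 ≤ variation f L d := by
      rcases h12 with h12 | h12 | h12
      · omega
      · omega
      · exact h12
    have := h.le_of_pairs h0 hs (d := d)
      (zone_of_not_int (2 * n + 2) (by push_cast; exact d1) (by push_cast; linarith))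
      (by intro h'; linarith) (by intro h'; linarith) hel (S := 3 * l - 1) (by
      have e : (3 * l - 1 : ℤ) = ∑ i ∈ Finset.range l, ((3 : ℤ) - if i = n then 1 else 0) := by
        rw [Finset.sum_sub_distrib, Finset.sum_ite_eq', if_pos (Finset.mem_range.2 hn)]
        simp [mul_comm]
      rw [e]
      refine Finset.sum_le_sum fun i hi => ?_
      split_ifs with hin
      · rw [hin]; linarith
      · have := c2 i (Finset.mem_range.1 hi) hin
        linarith)
    linarith

/-! ### Perturbations of the seesaw element -/

/-- A profile of `u` can be read off from the positions relative to the seesaw element. -/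
theorem profile_of_map {l a : ℕ} (ha : 1 ≤ a) {u : ThompsonF} (τ : ℚ → ℚ)
    (hτ : ∀ c, pos u c = τ (pos (seesawWord (l + 1) (a + 1)) c))
    (odd : ∀ i ≤ l, zone (τ (i + 1 / 2)) ≠ 0) (last : zone (τ (l + 3 / 2)) = 2)
    (nonpos : ∀ j < a, zone (τ (-j)) ≠ 1) (right : zone (τ (l + 2)) = 1)
    (left : zone (τ (-a)) = 0) : Profile l a u where
  odd i hi := by
    rw [hτ, pos_seesawWord_odd _ _ _ (by omega) ha]; exact odd i hi
  last := by
    have := pos_seesawWord_odd (l + 1) a (l + 1) le_rfl ha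
    push_cast at this
    rw [hτ, show 2 * (l : ℚ) + 3 = 2 * (l + 1) + 1 by ring, this,
      show (l : ℚ) + 1 + 1 / 2 = l + 3 / 2 by ring]
    exact last
  nonpos j hj := by
    rw [hτ, pos_seesawWord_nonpos _ _ _ hj]; exact nonpos j hj
  right := by
    have := pos_seesawWord_right (l + 1) a ha
    push_cast at this
    rw [hτ, show 2 * (l : ℚ) + 7 / 2 = 2 * (l + 1) + 3 / 2 by ring, this,
      show (l : ℚ) + 1 + 1 = l + 2 by ring]
    exact right
  left := by
    rw [hτ, pos_seesawWord_left]; exact left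

theorem pos_seesawWord_even' {l a : ℕ} (ha : 1 ≤ a) {i : ℕ} (hi : i ≤ l) :
    pos (seesawWord (l + 1) (a + 1)) (2 * i + 2) = i + 1 := by
  have := pos_seesawWord_even (l + 1) a (i + 1) (by omega) ha
  push_cast at this
  rwa [show 2 * (i : ℚ) + 2 = 2 * (i + 1) by ring]

theorem third_ne (l a : ℕ) : zone (1 / 3) = 2 ∧ (1 / 3 : ℚ) ≠ 2 * l + 7 / 2 ∧
    (1 / 3 : ℚ) ≠ -a + 1 / 2 := by
  refine ⟨zone_of_not_int 0 (by norm_num) (by norm_num), fun h => ?_, fun h => ?_⟩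
  · have : (0 : ℚ) ≤ l := by positivity
    linarith
  · have : (6 * a : ℚ) = 1 := by linarith
    norm_cast at this
    omega

theorem le_wordLength_of_map {l a : ℕ} (ha : 1 ≤ a) {u : ThompsonF} (τ : ℚ → ℚ)
    (hτ : ∀ c, pos u c = τ (pos (seesawWord (l + 1) (a + 1)) c))
    (odd : ∀ i ≤ l, zone (τ (i + 1 / 2)) ≠ 0) (last : zone (τ (l + 3 / 2)) = 2)
    (nonpos : ∀ j < a, zone (τ (-j)) ≠ 1) (right : zone (τ (l + 2)) = 1)
    (left : zone (τ (-a)) = 0) (even : ∀ i ≤ l, zone (τ (i + 1)) = 1) :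
    3 * l + 2 * a + 9 ≤ wordLength gens u := by
  obtain ⟨h1, h2, h3⟩ := third_ne l a
  have := (profile_of_map ha τ hτ odd last nonpos right left).le_wordLength (fun i hi => by
    rw [hτ, pos_seesawWord_even' ha hi]; exact even i hi) h1 h2 h3
  have := zone_le (pos u (1 / 3))
  omega

theorem zone_nat_add_half (i : ℕ) : zone ((i : ℚ) + 1 / 2) = 2 :=
  zone_of_not_int i (by push_cast; linarith) (by push_cast; linarith)

theorem le_wordLength_seesawWord {l a : ℕ} (ha : 1 ≤ a) :
    3 * l + 2 * a + 9 ≤ wordLength gens (seesawWord (l + 1) (a + 1)) := by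
  refine le_wordLength_of_map ha id (fun _ => rfl) (fun i _ => ?_) ?_ (fun j _ => ?_) ?_ ?_
    (fun i _ => ?_) <;> simp only [id]
  · rw [zone_nat_add_half]; norm_num
  · exact zone_of_not_int (l + 1) (by push_cast; linarith) (by push_cast; linarith)
  · exact zone_ne_one (by simp)
  · exact zone_of_pos (l + 2) (by push_cast; rfl) (by omega)
  · exact zone_of_nonpos (-a) (by push_cast; rfl) (by omega)
  · exact zone_of_pos (i + 1) (by push_cast; rfl) (by omega)

theorem double_add_of_le {z j : ℚ} (h : z ≤ j) : double (z - j) + j = z := by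
  rw [double, if_pos (by linarith)]; ring

theorem double_add_of_ge {z j : ℚ} (h : j + 1 ≤ z) : double (z - j) + j = z + 1 := by
  rw [double, if_neg (by linarith)]; split_ifs <;> linarith

theorem half_add_of_le {z j : ℚ} (h : z ≤ j) : half (z - j) + j = z := by
  rw [half, if_pos (by linarith)]; ring

theorem half_add_of_ge {z j : ℚ} (h : j + 2 ≤ z) : half (z - j) + j = z - 1 := by
  rw [half, if_neg (by linarith)]; split_ifs <;> linarith

/-- Splitting a tree to the right of the origin does not shorten. -/
theorem le_wordLength_split_right {l a : ℕ} (ha : 1 ≤ a) {j : ℕ} (hj : j ≤ l) :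
    3 * l + 2 * a + 9 ≤ wordLength gens
      (seesawWord (l + 1) (a + 1) * (x 0)⁻¹ ^ j * x 1) + j := by
  refine le_trans ?_ (wordLength_mul_x_zero_pow_le _ j)
  have hj' : (j : ℚ) ≤ l := by exact_mod_cast hj
  have hj0 : (0 : ℚ) ≤ j := by positivity
  refine le_wordLength_of_map ha (fun z => double (z - j) + j) (fun c => by
    rw [pos_mul_x_zero_pow, pos_mul_x_one, pos_mul_x_zero_inv_pow])
    (fun i hi => ?_) ?_ (fun i _ => ?_) ?_ ?_ (fun i hi => ?_)
  · refine zone_ne_zero ?_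
    have hi0 : (0 : ℚ) ≤ i := by positivity
    unfold double; split_ifs <;> linarith
  · rw [double_add_of_ge (by linarith)]
    exact zone_of_not_int (l + 2) (by push_cast; linarith) (by push_cast; linarith)
  · have : (0 : ℚ) ≤ i := by positivity
    rw [double_add_of_le (by linarith)]
    exact zone_ne_one (by linarith)
  · rw [double_add_of_ge (by linarith)]
    exact zone_of_pos (l + 3) (by push_cast; ring) (by omega)
  · have : (0 : ℚ) ≤ a := by positivity
    rw [double_add_of_le (by linarith)]
    exact zone_of_nonpos (-a) (by push_cast; rfl) (by omega)
  · rcases le_or_gt (i + 1) j with h | h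
    · rw [double_add_of_le (by exact_mod_cast h)]
      exact zone_of_pos (i + 1) (by push_cast; rfl) (by omega)
    · rw [double_add_of_ge (by exact_mod_cast h)]
      exact zone_of_pos (i + 2) (by push_cast; ring) (by omega)

/-- Joining two trees to the right of the origin does not shorten. -/
theorem le_wordLength_join_right {l a : ℕ} (ha : 1 ≤ a) {j : ℕ} (hj : j < l) :
    3 * l + 2 * a + 9 ≤ wordLength gens
      (seesawWord (l + 1) (a + 1) * (x 0)⁻¹ ^ j * (x 1)⁻¹) + j := by
  refine le_trans ?_ (wordLength_mul_x_zero_pow_le _ j)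
  have hj' : (j : ℚ) + 1 ≤ l := by exact_mod_cast hj
  have hj0 : (0 : ℚ) ≤ j := by positivity
  have hτ : ∀ c, pos (seesawWord (l + 1) (a + 1) * (x 0)⁻¹ ^ j * (x 1)⁻¹ * x 0 ^ j) c =
      half (pos (seesawWord (l + 1) (a + 1)) c - j) + j := fun c => by
    rw [pos_mul_x_zero_pow, pos_mul_x_one_inv, pos_mul_x_zero_inv_pow]
  have := (profile_of_map ha (fun z => half (z - j) + j) hτ (fun i hi => ?_) ?_ (fun i _ => ?_)
    ?_ ?_).le_wordLength_of_join hj (fun i hi hin => ?_) ?_ ?_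
  · exact_mod_cast this
  · refine zone_ne_zero ?_
    have hi0 : (0 : ℚ) ≤ i := by positivity
    unfold half; split_ifs <;> linarith
  · rw [half_add_of_ge (by linarith)]
    exact zone_of_not_int l (by push_cast; linarith) (by push_cast; linarith)
  · have : (0 : ℚ) ≤ i := by positivity
    rw [half_add_of_le (by linarith)]
    exact zone_ne_one (by linarith)
  · rw [half_add_of_ge (by linarith)]
    exact zone_of_pos (l + 1) (by push_cast; ring) (by omega)
  · have : (0 : ℚ) ≤ a := by positivity
    rw [half_add_of_le (by linarith)]
    exact zone_of_nonpos (-a) (by push_cast; rfl) (by omega)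
  · rw [hτ, pos_seesawWord_even' ha hi]
    rcases lt_or_gt_of_ne hin with h | h
    · have h' : (i : ℚ) + 1 ≤ j := by exact_mod_cast h
      rw [half_add_of_le h']
      exact zone_of_pos (i + 1) (by push_cast; rfl) (by omega)
    · have h' : (j : ℚ) + 1 ≤ i := by exact_mod_cast h
      rw [half_add_of_ge (by linarith)]
      exact zone_of_pos i (by push_cast; ring) (by omega)
  · rw [hτ, pos_seesawWord_even' ha hj.le, add_sub_cancel_left]
    norm_num [half]; ring
  · have := pos_seesawWord_odd (l + 1) a (j + 1) (by omega) ha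
    push_cast at this
    rw [hτ, show 2 * (j : ℚ) + 3 = 2 * (j + 1) + 1 by ring, this,
      show (j : ℚ) + 1 + 1 / 2 - j = 3 / 2 by ring]
    norm_num [half]; ring

theorem pos_seesawWord_nonpos_half (l a i : ℕ) (h1 : 1 ≤ i) (h2 : i + 1 ≤ a) :
    pos (seesawWord l (a + 1)) (-i + 1 / 2) = -i + 1 / 2 := by
  have h1' : (1 : ℚ) ≤ i := by exact_mod_cast h1
  have h2' : (i : ℚ) + 1 ≤ a := by exact_mod_cast h2
  obtain ⟨h1, h2⟩ := action_left_eq l (z := -i + 1 / 2) (by linarith)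
  refine pos_seesawWord_eq l a (v := -i + 1 / 2 + a) h1 h2 ?_ ?_
  · unfold half; split_ifs <;> linarith
  · ring

/-- Splitting a tree to the left of the origin does not shorten. -/
theorem le_wordLength_split_left {l a : ℕ} {i : ℕ} (hi : 1 ≤ i) (hia : i < a) :
    3 * l + 2 * a + 9 ≤ wordLength gens
      (seesawWord (l + 1) (a + 1) * x 0 ^ i * x 1) + i := by
  have hi' : (1 : ℚ) ≤ i := by exact_mod_cast hi
  have hia' : (i : ℚ) + 1 ≤ a := by exact_mod_cast hia
  have hle := wordLength_mul_x_zero_inv_pow_le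
    (seesawWord (l + 1) (a + 1) * x 0 ^ i * x 1) (i + 1)
  have hτ : ∀ c, pos (seesawWord (l + 1) (a + 1) * x 0 ^ i * x 1 * (x 0)⁻¹ ^ (i + 1)) c =
      double (pos (seesawWord (l + 1) (a + 1)) c - -i) + -i - 1 := fun c => by
    rw [pos_mul_x_zero_inv_pow, pos_mul_x_one, pos_mul_x_zero_pow, sub_neg_eq_add]
    push_cast; ring
  have hge : ∀ z : ℚ, -i + 1 ≤ z → double (z - -i) + -i - 1 = z := fun z hz => by
    rw [double_add_of_ge hz]; ring
  have := (profile_of_map (l := l) (by omega) (fun z => double (z - -i) + -i - 1) hτ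
    (fun j _ => ?_) ?_ (fun j _ => ?_) ?_ ?_).le_wordLength (fun j hj => ?_)
    (d := -i + 1 / 2) ?_ ?_ ?_
  · rw [hτ, pos_seesawWord_nonpos_half _ _ _ hi (by omega),
      show -(i : ℚ) + 1 / 2 - -i = 1 / 2 by ring,
      show double (1 / 2) = 1 by norm_num [double], zone_of_nonpos (-i) (by push_cast; ring)
        (by omega)] at this
    omega
  · have : (0 : ℚ) ≤ j := by positivity
    rw [hge _ (by linarith), zone_nat_add_half]; norm_num
  · have : (0 : ℚ) ≤ l := by positivity
    rw [hge _ (by linarith)]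
    exact zone_of_not_int (l + 1) (by push_cast; linarith) (by push_cast; linarith)
  · rcases le_or_gt i j with h | h
    · have h' : (i : ℚ) ≤ j := by exact_mod_cast h
      rw [double_add_of_le (by linarith)]
      exact zone_ne_one (by linarith)
    · have h' : (j : ℚ) + 1 ≤ i := by exact_mod_cast h
      rw [hge _ (by linarith)]
      exact zone_ne_one (by simp)
  · have : (0 : ℚ) ≤ l := by positivity
    rw [hge _ (by linarith)]
    exact zone_of_pos (l + 2) (by push_cast; rfl) (by omega)
  · rw [double_add_of_le (by linarith)]
    exact zone_of_nonpos (-a - 1) (by push_cast; ring) (by omega)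
  · have : (0 : ℚ) ≤ j := by positivity
    rw [hτ, pos_seesawWord_even' (by omega) hj, hge _ (by linarith)]
    exact zone_of_pos (j + 1) (by push_cast; rfl) (by omega)
  · exact zone_of_not_int (-i) (by push_cast; linarith) (by push_cast; linarith)
  · have : (0 : ℚ) ≤ l := by positivity
    intro h; linarith
  · intro h; linarith

/-- Joining two trees to the left of the origin does not shorten. -/
theorem le_wordLength_join_left {l a : ℕ} {i : ℕ} (hi : 1 ≤ i) (hia : i < a) :
    3 * l + 2 * a + 9 ≤ wordLength gens
      (seesawWord (l + 1) (a + 1) * x 0 ^ i * (x 1)⁻¹) + i := by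
  obtain ⟨i, rfl⟩ : ∃ b, i = b + 1 := ⟨i - 1, by omega⟩
  have hi0 : (0 : ℚ) ≤ i := by positivity
  have hia' : (i : ℚ) + 1 + 1 ≤ a := by exact_mod_cast hia
  refine le_trans ?_ (Nat.add_le_add_left (Nat.le_succ i) _)
  refine le_trans ?_ (wordLength_mul_x_zero_inv_pow_le _ i)
  have hge : ∀ z : ℚ, -i + 1 ≤ z → half (z - -(i + 1)) + -(i + 1) + 1 = z := fun z hz => by
    rw [half_add_of_ge (by linarith)]; ring
  refine le_wordLength_of_map (by omega) (fun z => half (z - -(i + 1)) + -(i + 1) + 1)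
    (fun c => by
      rw [pos_mul_x_zero_inv_pow, pos_mul_x_one_inv, pos_mul_x_zero_pow, sub_neg_eq_add]
      push_cast; ring)
    (fun j _ => ?_) ?_ (fun j _ => ?_) ?_ ?_ (fun j hj => ?_)
  · have : (0 : ℚ) ≤ j := by positivity
    refine zone_ne_zero ?_
    unfold half; split_ifs <;> linarith
  · have : (0 : ℚ) ≤ l := by positivity
    rw [hge _ (by linarith)]
    exact zone_of_not_int (l + 1) (by push_cast; linarith) (by push_cast; linarith)
  · rcases lt_trichotomy i j with h | rfl | h
    · have h' : (i : ℚ) + 1 ≤ j := by exact_mod_cast h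
      rw [half_add_of_le (by linarith)]
      exact zone_ne_one (by linarith)
    · rw [show -(i : ℚ) - -(i + 1) = 1 by ring, show half 1 = 1 / 2 by norm_num [half],
        zone_of_not_int (-i) (by push_cast; linarith) (by push_cast; linarith)]
      norm_num
    · have h' : (j : ℚ) + 1 ≤ i := by exact_mod_cast h
      rw [hge _ (by linarith)]
      exact zone_ne_one (by simp)
  · have : (0 : ℚ) ≤ l := by positivity
    rw [hge _ (by linarith)]
    exact zone_of_pos (l + 2) (by push_cast; rfl) (by omega)
  · rw [half_add_of_le (by linarith)]
    exact zone_of_nonpos (-a + 1) (by push_cast; ring) (by omega)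
  · have : (0 : ℚ) ≤ j := by positivity
    rw [hge _ (by linarith)]
    exact zone_of_pos (j + 1) (by push_cast; rfl) (by omega)

/-! ### The seesaw property -/

theorem wordLength_seesawWord_mul_pow {l a i : ℕ} (hi : i ≤ a + 2) :
    wordLength gens (seesawWord (l + 1) (a + 2) * x 0 ^ i) + i = 3 * l + 2 * a + 11 := by
  have h1 := wordLength_seesawWord_mul_pow_le (l + 1) a i hi
  have h2 := le_wordLength_seesawWord (l := l) (a := a + 1) (by omega)
  have h3 := wordLength_mul_x_zero_inv_pow_le (seesawWord (l + 1) (a + 2) * x 0 ^ i) i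
  rw [inv_pow, mul_inv_cancel_right] at h3
  change _ ≤ wordLength gens (seesawWord (l + 1) (a + 2)) at h2
  omega

theorem wordLength_seesawWord_mul_inv_pow {l a i : ℕ} (hi : i ≤ l + 1) :
    wordLength gens (seesawWord (l + 1) (a + 2) * (x 0)⁻¹ ^ i) + i = 3 * l + 2 * a + 11 := by
  have h1 := wordLength_seesawWord_mul_inv_pow_le (l + 1) (a + 1) i hi
  have h2 := le_wordLength_seesawWord (l := l) (a := a + 1) (by omega)
  have h3 := wordLength_mul_x_zero_pow_le (seesawWord (l + 1) (a + 2) * (x 0)⁻¹ ^ i) i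
  rw [inv_pow, inv_mul_cancel_right] at h3
  rw [inv_pow] at *
  change _ ≤ wordLength gens (seesawWord (l + 1) (a + 2)) at h2
  change wordLength gens (seesawWord (l + 1) (a + 2) * _) + _ ≤ _ at h1
  omega

theorem cases_of_mem {h : ThompsonF} (hh : h ∈ gens ∨ h⁻¹ ∈ gens) :
    h = x 0 ∨ h = (x 0)⁻¹ ∨ h = x 1 ∨ h = (x 1)⁻¹ := by
  rcases hh with (hh | hh) | (hh | hh)
  · exact Or.inl hh
  · exact Or.inr (Or.inr (Or.inl hh))
  · exact Or.inr (Or.inl (inv_eq_iff_eq_inv.1 hh))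
  · exact Or.inr (Or.inr (Or.inr (inv_eq_iff_eq_inv.1 hh)))

theorem isSeesaw_seesawWord {l a n : ℕ} (hl0 : 0 < l) (hl : n ≤ l) (ha : n ≤ a + 1) :
    IsSeesaw gens (x 0) n (seesawWord (l + 1) (a + 2)) := by
  have hP := fun i (hi : i ≤ a + 2) => wordLength_seesawWord_mul_pow (l := l) hi
  have hN := fun i (hi : i ≤ l + 1) => wordLength_seesawWord_mul_inv_pow (a := a) hi
  have h0 := hP 0 (by omega)
  rw [pow_zero, mul_one] at h0
  refine
    { finite := ?_
      generates := closure_gens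
      mem := x_zero_mem
      down_pos := ?_
      down_neg := ?_
      other := ?_
      swing_pos := ?_
      only_pos := ?_
      swing_neg := ?_
      only_neg := ?_ }
  · exact Set.toFinite {x 0, x 1}
  · have := hP 1 (by omega)
    rw [pow_one] at this
    omega
  · have := hN 1 (by omega)
    rw [pow_one] at this
    omega
  · intro h hh h1 h2
    have s1 := le_wordLength_split_right (l := l) (a := a + 1) (by omega) (j := 0) (by omega)
    rcases cases_of_mem hh with rfl | rfl | rfl | rfl
    · exact absurd rfl h1
    · exact absurd rfl h2
    · simp only [pow_zero, mul_one] at s1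
      change _ ≤ wordLength gens (seesawWord (l + 1) (a + 2) * _) + _ at s1
      omega
    · have s1 := le_wordLength_join_right (l := l) (a := a + 1) (by omega) (j := 0) hl0
      simp only [pow_zero, mul_one] at s1
      change _ ≤ wordLength gens (seesawWord (l + 1) (a + 2) * _) + _ at s1
      omega
  · intro i h1 h2
    have e1 := hP i (by omega)
    have e2 := hP (i - 1) (by omega)
    omega
  · intro i h1 h2 h hh hne
    have e1 := hP i (by omega)
    rcases cases_of_mem hh with rfl | rfl | rfl | rfl
    · exact absurd rfl hne
    · have e2 := hP (i - 1) (by omega)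
      rw [show x 0 ^ i = x 0 ^ (i - 1) * x 0 by rw [← pow_succ]; congr 1; omega, ← mul_assoc,
        mul_inv_cancel_right, mul_assoc, ← pow_succ, show i - 1 + 1 = i by omega]
      omega
    · have s1 := le_wordLength_split_left (l := l) (a := a + 1) h1 (by omega)
      change _ ≤ wordLength gens (seesawWord (l + 1) (a + 2) * _ * _) + _ at s1
      omega
    · have s1 := le_wordLength_join_left (l := l) (a := a + 1) h1 (by omega)
      change _ ≤ wordLength gens (seesawWord (l + 1) (a + 2) * _ * _) + _ at s1
      omega
  · intro i h1 h2
    have e1 := hN i (by omega)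
    have e2 := hN (i - 1) (by omega)
    omega
  · intro i h1 h2 h hh hne
    have e1 := hN i (by omega)
    rcases cases_of_mem hh with rfl | rfl | rfl | rfl
    · have e2 := hN (i - 1) (by omega)
      rw [show (x 0)⁻¹ ^ i = (x 0)⁻¹ ^ (i - 1) * (x 0)⁻¹ by rw [← pow_succ]; congr 1; omega,
        ← mul_assoc, inv_mul_cancel_right, mul_assoc, ← pow_succ, show i - 1 + 1 = i by omega]
      omega
    · exact absurd rfl hne
    · have s1 := le_wordLength_split_right (l := l) (a := a + 1) (by omega) (j := i) (by omega)
      change _ ≤ wordLength gens (seesawWord (l + 1) (a + 2) * _ * _) + _ at s1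
      omega
    · have s1 := le_wordLength_join_right (l := l) (a := a + 1) (by omega) (j := i) (by omega)
      change _ ≤ wordLength gens (seesawWord (l + 1) (a + 2) * _ * _) + _ at s1
      omega

/-! ### Fellow travelling -/

theorem wordLength_getVert_le {v : ThompsonF} (p : (SimpleGraph.mulCayley gens).Walk 1 v) (t : ℕ) :
    wordLength gens (p.getVert t) ≤ t := by
  refine (SimpleGraph.dist_le (p.take t)).trans ?_
  rw [SimpleGraph.Walk.take_length]
  exact min_le_left _ _

/-- A geodesic to `w * s` runs along the swing. -/
theorem getVert_geodesic {w s : ThompsonF} {n N : ℕ} (hN : n ≤ N)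
    (hlen : ∀ i ≤ n, wordLength gens (w * s ^ i) + i = N)
    (hs : ∀ i, 1 ≤ i → i < n → ∀ h, h ∈ gens ∨ h⁻¹ ∈ gens → h ≠ s →
      wordLength gens (w * s ^ i) ≤ wordLength gens (w * s ^ i * h))
    (p : (SimpleGraph.mulCayley gens).Walk 1 (w * s)) (hp : IsGeodesic p) {i : ℕ} (h1 : 1 ≤ i)
    (hi : i ≤ n) : p.getVert (N - i) = w * s ^ i := by
  have hl := hlen 1 (h1.trans hi)
  rw [pow_one] at hl
  have hpl : p.length + 1 = N := by rw [hp]; exact hl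
  induction i, h1 using Nat.le_induction with
  | base => rw [← hpl, Nat.add_sub_cancel, p.getVert_length, pow_one]
  | succ i h1 ih =>
    have ih := ih (by omega)
    have hadj := p.adj_getVert_succ (i := N - (i + 1)) (by omega)
    rw [show N - (i + 1) + 1 = N - i by omega, ih, SimpleGraph.adj_comm,
      SimpleGraph.mulCayley_adj'] at hadj
    have hle := wordLength_getVert_le p (N - (i + 1))
    have hlt := hlen i (by omega)
    obtain ⟨h, hh, e⟩ : ∃ h, (h ∈ gens ∨ h⁻¹ ∈ gens) ∧
        p.getVert (N - (i + 1)) = w * s ^ i * h := by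
      obtain ⟨-, g, hg, e | e⟩ := hadj
      · exact ⟨g, Or.inl hg, e.symm⟩
      · exact ⟨g⁻¹, Or.inr (by rwa [inv_inv]), by rw [e]; group⟩
    by_cases hne : h = s
    · rw [e, hne, pow_succ, mul_assoc]
    · have := hs i h1 (by omega) h hh hne
      rw [← e] at this
      omega

theorem expSum_dist_le {u v : ThompsonF} (p : (SimpleGraph.mulCayley gens).Walk u v) :
    |(expSum v).toAdd - (expSum u).toAdd| ≤ p.length := by
  induction p with
  | nil => simp
  | cons h p ih =>
    have h0 := expSum_x_zero
    have h1 := expSum_x_one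
    rw [SimpleGraph.Walk.length_cons]
    rw [abs_le] at ih ⊢
    rcases step_of_adj h with e | e | e | e <;> subst e <;>
      simp only [map_mul, map_inv, toAdd_mul, toAdd_inv, h0, h1] at ih <;>
      push_cast <;> constructor <;> linarith [ih.1, ih.2]

theorem le_of_edist_le {w : ThompsonF} {n k : ℕ}
    (h : (SimpleGraph.mulCayley gens).edist (w * x 0 ^ n) (w * (x 0)⁻¹ ^ n) ≤ (2 * k : ℕ)) :
    n ≤ k := by
  obtain ⟨p, hp⟩ := SimpleGraph.exists_walk_of_edist_ne_top
    (ne_top_of_le_ne_top (ENat.natCast_ne_top _) h)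
  rw [← hp] at h
  have h1 : p.length ≤ 2 * k := by exact_mod_cast h
  have h2 := expSum_dist_le p
  simp only [map_mul, map_pow, map_inv, toAdd_mul, toAdd_pow, toAdd_inv, expSum_x_zero] at h2
  rw [abs_le] at h2
  have := h2.1
  simp only [nsmul_eq_mul, mul_neg, mul_one] at this
  omega

end Seesaw

/-- For every `k` there is a seesaw word `w` in the family `𝒮` such that no choice of geodesic
paths from `1` to the three elements `w`, `w x_0`, `w x_0⁻¹` of the Cayley graph of `F` satisfies
the `k`-fellow traveller property. -/
theorem proposition4p2 (k : ℕ) :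
    ∃ w ∈ Seesaw.seesawFamily,
      (∃ n : ℕ, 1 ≤ n ∧ Seesaw.IsSeesaw Seesaw.gens (Seesaw.x 0) n w) ∧
      ¬ ∃ γ : ∀ v : ({w, w * Seesaw.x 0, w * (Seesaw.x 0)⁻¹} : Set Seesaw.ThompsonF),
          Seesaw.cayleyF.Walk 1 v,
        (∀ v, Seesaw.IsGeodesic (γ v)) ∧ Seesaw.FellowTraveller k γ := by
  have hsee := Seesaw.isSeesaw_seesawWord (l := k + 1) (a := k + 1) (n := k + 1) k.succ_pos le_rfl
    (by omega)
  have hP := fun i (hi : i ≤ k + 1) =>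
    Seesaw.wordLength_seesawWord_mul_pow (l := k + 1) (a := k + 1) (i := i) (by omega)
  have hN := fun i (hi : i ≤ k + 1) =>
    Seesaw.wordLength_seesawWord_mul_inv_pow (l := k + 1) (a := k + 1) (i := i) (by omega)
  refine ⟨Seesaw.seesawWord (k + 1 + 1) (k + 1 + 2), ⟨_, _, by omega, by omega, rfl⟩,
    ⟨k + 1, by omega, hsee⟩, ?_⟩
  generalize Seesaw.seesawWord (k + 1 + 1) (k + 1 + 2) = w at *
  rintro ⟨γ, hgeo, hft⟩
  set u₀ : ({w, w * Seesaw.x 0, w * (Seesaw.x 0)⁻¹} : Set Seesaw.ThompsonF) := ⟨w, by simp⟩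
  set u₁ : ({w, w * Seesaw.x 0, w * (Seesaw.x 0)⁻¹} : Set Seesaw.ThompsonF) :=
    ⟨w * Seesaw.x 0, by simp⟩
  set u₂ : ({w, w * Seesaw.x 0, w * (Seesaw.x 0)⁻¹} : Set Seesaw.ThompsonF) :=
    ⟨w * (Seesaw.x 0)⁻¹, by simp⟩
  have hdp := hsee.down_pos
  have hdn := hsee.down_neg
  have d1 : Seesaw.cayleyF.dist (u₁ : Seesaw.ThompsonF) u₀ = 1 := by
    refine SimpleGraph.dist_eq_one_iff_adj.2 ?_
    rw [Seesaw.cayleyF, SimpleGraph.mulCayley_adj']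
    refine ⟨fun h => ?_, Seesaw.x 0, Seesaw.x_zero_mem, Or.inr rfl⟩
    change w * Seesaw.x 0 = w at h
    rw [h] at hdp
    omega
  have d2 : Seesaw.cayleyF.dist (u₀ : Seesaw.ThompsonF) u₂ = 1 := by
    refine SimpleGraph.dist_eq_one_iff_adj.2 ?_
    rw [Seesaw.cayleyF, SimpleGraph.mulCayley_adj']
    refine ⟨fun h => ?_, Seesaw.x 0, Seesaw.x_zero_mem, Or.inr (inv_mul_cancel_right _ _).symm⟩
    change w = w * (Seesaw.x 0)⁻¹ at h
    rw [← h] at hdn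
    omega
  set t := 3 * (k + 1) + 2 * (k + 1) + 11 - (k + 1)
  have e1 := (le_iSup (fun i : ℕ => Seesaw.cayleyF.edist ((γ u₁).getVert i) ((γ u₀).getVert i))
    t).trans (hft u₁ u₀ d1)
  have e2 := (le_iSup (fun i : ℕ => Seesaw.cayleyF.edist ((γ u₀).getVert i) ((γ u₂).getVert i))
    t).trans (hft u₀ u₂ d2)
  have v1 : (γ u₁).getVert t = w * Seesaw.x 0 ^ (k + 1) :=
    Seesaw.getVert_geodesic (by omega) hP hsee.only_pos (γ u₁) (hgeo u₁) (by omega) le_rfl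
  have v2 : (γ u₂).getVert t = w * (Seesaw.x 0)⁻¹ ^ (k + 1) :=
    Seesaw.getVert_geodesic (by omega) hN hsee.only_neg (γ u₂) (hgeo u₂) (by omega) le_rfl
  have h := (SimpleGraph.edist_triangle (v := (γ u₀).getVert t)).trans (add_le_add e1 e2)
  rw [v1, v2, ← two_mul] at h
  have := Seesaw.le_of_edist_le (n := k + 1) (k := k) (by exact_mod_cast h)
  omega
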